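/- Setting. Let $G=(V,E)$ be a finite directed graph with $n=|V|\ge 1$. In the triggering model every node $v$ independently samples a triggering set $T_v$ of in-neighbours of $v$ from a distribution $D_v$; a seed set $S$ is active at time $0$, an active node stays active, and $v$ becomes active at time $t\ge1$ if $T_v$ contains a node that is active at time $t-1$. Let $\sigma(S)$ be the expected number of eventually active nodes. Let $\mathcal D\subseteq\mathbb R^d_+$ be convex, $h_v:\mathbb R^d_+\to[0,1]$ $(v\in V)$, $c:\mathcal D\to\mathbb R$ convex, $k\ge0$, $\lambda\ge0$, and put $$\mathcal P=\{x\in\mathcal D: c(x)\le k\},\quad g(x)=\sum_{S\subseteq V}\sigma(S)\prod_{u\in S}h_u(x)\prod_{v\notin S}(1-h_v(x)),\quad s(x)=\lambda(k-c(x)),\quad \mathrm{OPT}=\sup_{x\in\mathcal P}(g+s)(x).$$ Assume that $\mathcal P$ is bounded and $\mathrm{OPT}\ge 1$. A reverse reachable (RR) set is the random set of nodes that can reach a uniformly random root $v$ in the live-edge graph with edges $\{(w,u):w\in T_u\}$. For a sequence $\mathcal R=(R_1,\dots,R_\theta)$ of RR sets let $\hat g_{\mathcal R}(x)=\frac n\theta\sum_{j}\bigl(1-\prod_{v\in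 R_j}(1-h_v(x))\bigr)$. Let $L_1\ge0$, $L_2>0$ be such that on $\mathcal P$, in the Euclidean norm, $g+s$ is $L_1$-Lipschitz and $\hat g_{\mathcal R}+s$ is $L_2$-Lipschitz for every nonempty sequence $\mathcal R$ of possible RR sets. $\mathcal N(\mathcal P,r)$ is the least cardinality of a finite $N\subset\mathbb R^d$ such that every $x\in\mathcal P$ is within Euclidean distance $r$ of a point of $N$. An algorithm $\mathcal A$ takes a sequence $\mathcal R$ of RR sets and an additive error $\delta>0$, and returns a point of $\mathcal P$. It has approximation ratio $\alpha$ if, for every $\delta>0$, it is an $(\alpha,\delta)$-approximate gradient algorithm for $\hat g_{\mathcal R}+s$ when run with additive error $\delta$: for every nonempty sequence $\mathcal R$ of possible RR sets its output $\hat x$ satisfies $(\hat g_{\mathcal R}+s)(\hat x)\ge\alpha\,(\hat g_{\mathcal R}+s)(y)-\delta$ for all $y\in\mathcal P$. Algorithm Grad-RIS (parameters $\varepsilon,\ell,\alpha>0$). Put $\varepsilon'=\sqrt2\,\varepsilon/3$ and initially $LB=1$. For $i=1,2,\dots,\lfloor\log_2(n+\lambda k)-1\rfloor$: let $x_i=(n+\lambda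 k)/2^i$ and $$\theta_i=\left\lceil n\left(2+\tfrac23\varepsilon'\right)\frac{\ln\mathcal N(\mathcal P,\frac{\varepsilon/3}{L_2}x_i)+\ell\ln n+\ln2+\ln\log_2(n+\lambda k)}{\varepsilon'^2x_i}\right\rceil;$$ enlarge the current collection of independent RR sets to a sequence $\mathcal R_i$ of $\theta_i$ of them; let $y_i$ be the output of $\mathcal A$ on $\mathcal R_i$ with additive error $\frac\varepsilon3x_i$; if $(\hat g_{\mathcal R_i}+s)(y_i)\ge(1+\varepsilon'+\frac\varepsilon3)x_i$, set $LB=(\hat g_{\mathcal R_i}+s)(y_i)/(1+\varepsilon'+\frac\varepsilon3)$ and leave the loop. Then, with $\alpha'=\alpha-\varepsilon/3$, let $$\theta^{(1)}=\frac{8n\ln(4n^\ell)}{LB\,\alpha'^2\,\varepsilon^2/9},\qquad \theta^{(2)}=\frac{2\alpha' n\ln\bigl(4n^\ell\,\mathcal N(\mathcal P,\frac{\varepsilon/3}{L_1+L_2}LB)\bigr)}{\bigl(\frac\varepsilon3-\frac12\alpha'^2\frac\varepsilon3\bigr)^2LB},$$ generate a sequence $\mathcal R$ of $\lceil\max\{\theta^{(1)},\theta^{(2)}\}\rceil$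 fresh independent RR sets, and output the point that $\mathcal A$ returns on $\mathcal R$ with additive error $\frac\varepsilon3LB$. Theorem. For all $\varepsilon,\ell,\alpha>0$ and every algorithm $\mathcal A$ with approximation ratio $\alpha$, with probability at least $1-1/n^\ell$ Grad-RIS outputs a point $x\in\mathcal P$ with $$(g+s)(x)\ge(\alpha-\varepsilon)\,\mathrm{OPT}.$$ -/

import Mathlib

open MeasureTheory
open scoped ENNReal

noncomputable section

/-- An instance of continuous influence maximization with budget saving (CIM-BS): a social network
with node set `V` under the triggering model, a convex domain of strategy mixes in `ℝ₊^d`, strategy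
activation functions, a convex cost function, a budget and a balance parameter. -/
structure CIMBS (V : Type*) (d : ℕ) where
  /-- the directed social network; `graph.Adj u v` means that `u` can directly influence `v` -/
  graph : Digraph V
  /-- the distribution of the triggering set of each node -/
  trig : V → PMF (Finset V)
  /-- triggering sets consist of in-neighbours -/
  trig_subset : ∀ v, ∀ T ∈ (trig v).support, ∀ u ∈ T, graph.Adj u v
  /-- the domain of strategy mixes -/
  dom : Set (EuclideanSpace ℝ (Fin d))
  dom_convex : Convex ℝ dom
  dom_nonneg : ∀ x ∈ dom, ∀ i, 0 ≤ x i
  /-- strategy activation functions -/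
  h : V → EuclideanSpace ℝ (Fin d) → ℝ
  h_mem : ∀ v x, (∀ i, 0 ≤ x i) → h v x ∈ Set.Icc (0 : ℝ) 1
  /-- cost of a strategy mix -/
  cost : EuclideanSpace ℝ (Fin d) → ℝ
  cost_convex : ConvexOn ℝ dom cost
  /-- the total budget `k` -/
  budget : ℝ
  budget_nonneg : 0 ≤ budget
  /-- the balance parameter `λ` -/
  lam : ℝ
  lam_nonneg : 0 ≤ lam

/-- Nodes active at time `t` when the triggering sets are `T` and the seed set is `S`. -/
def activeAt {V : Type*} [Fintype V] [DecidableEq V] (T : V → Finset V) (S : Finset V) :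
    ℕ → Finset V
  | 0 => S
  | t + 1 => activeAt T S t ∪ Finset.univ.filter fun v => (T v ∩ activeAt T S t).Nonempty

open Classical in
/-- Nodes that are eventually active. -/
def finalActive {V : Type*} [Fintype V] [DecidableEq V] (T : V → Finset V) (S : Finset V) :
    Finset V :=
  Finset.univ.filter fun v => ∃ t, v ∈ activeAt T S t

open Classical in
/-- The nodes that can reach `v` in the live-edge graph with edges `{(w, u) | w ∈ T u}`. -/
def rrSet {V : Type*} [Fintype V] (v : V) (T : V → Finset V) : Finset V :=
  Finset.univ.filter fun u => Relation.ReflTransGen (fun w w' => w ∈ T w') u v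

/-- `f` is `L`-Lipschitz on `P` with respect to the 2-norm. -/
def IsLipschitzOn {d : ℕ} (f : EuclideanSpace ℝ (Fin d) → ℝ) (L : ℝ)
    (P : Set (EuclideanSpace ℝ (Fin d))) : Prop :=
  ∀ x ∈ P, ∀ y ∈ P, |f x - f y| ≤ L * ‖x - y‖

/-- The covering number of `P` at radius `r` (net points need not lie in `P`), as a real number. -/
def covNum {d : ℕ} (P : Set (EuclideanSpace ℝ (Fin d))) (r : ℝ) : ℝ :=
  ((Metric.externalCoveringNumber r.toNNReal P).toNat : ℝ)

namespace CIMBS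

variable {V : Type*} [Fintype V] [DecidableEq V] {d : ℕ} (M : CIMBS V d)

/-- The joint law of the triggering sets: independent, with law `trig v` at node `v`. -/
def trigMeasure : Measure (V → Finset V) :=
  Measure.pi fun v => (M.trig v).toMeasure

instance : IsProbabilityMeasure M.trigMeasure := by
  unfold trigMeasure; infer_instance

/-- Influence spread of a seed set: expected number of eventually active nodes. -/
def spread (S : Finset V) : ℝ :=
  ∫ T, ((finalActive T S).card : ℝ) ∂M.trigMeasure

/-- Influence spread of a strategy mix. -/
def g (x : EuclideanSpace ℝ (Fin d)) : ℝ :=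
  ∑ S : Finset V, M.spread S * (∏ u ∈ S, M.h u x) * ∏ v ∈ Sᶜ, (1 - M.h v x)

/-- The budget-saving part of the objective, `λ (k - c(x))`. -/
def s (x : EuclideanSpace ℝ (Fin d)) : ℝ :=
  M.lam * (M.budget - M.cost x)

/-- The feasible region. -/
def feasible : Set (EuclideanSpace ℝ (Fin d)) :=
  {x | x ∈ M.dom ∧ M.cost x ≤ M.budget}

/-- The optimal value of the budget-balanced influence spread `g + s` on the feasible region. -/
def opt : ℝ :=
  sSup ((fun x => M.g x + M.s x) '' M.feasible)

/-- The law of an RR set whose root is uniformly random: the average over all roots. -/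
def rrLaw : Measure (Finset V) :=
  (Fintype.card V : ℝ≥0∞)⁻¹ • ∑ v : V, M.trigMeasure.map (rrSet v)

instance [Nonempty V] : IsProbabilityMeasure M.rrLaw := by
  constructor
  have hv : ∀ v : V, (M.trigMeasure.map (rrSet v)) Set.univ = 1 := fun v => by
    rw [Measure.map_apply (measurable_of_countable _) MeasurableSet.univ]
    simp
  simp only [rrLaw, Measure.smul_apply, Measure.coe_finsetSum, Finset.sum_apply, hv, smul_eq_mul]
  simp [ENNReal.inv_mul_cancel]

/-- `R` is an RR set that occurs with positive probability. -/
def IsRRSet (R : Finset V) : Prop :=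
  ∃ (v : V) (T : V → Finset V), (∀ u, T u ∈ (M.trig u).support) ∧ R = rrSet v T

/-- The estimate of `g` from a sequence of `θ` RR sets. -/
def gHat {θ : ℕ} (R : Fin θ → Finset V) (x : EuclideanSpace ℝ (Fin d)) : ℝ :=
  (Fintype.card V : ℝ) / θ * ∑ j, (1 - ∏ v ∈ R j, (1 - M.h v x))

/-- The algorithm `A`, taking a sequence of RR sets to a strategy mix, is
`(α, δ)`-approximate for the objectives `ĝ_R + s`: it returns a feasible point whose value is at
least `α` times the maximum of `ĝ_R + s` over the feasible region, minus `δ`. -/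
def IsApproxGradientAlgorithm
    (A : (θ : ℕ) → (Fin θ → Finset V) → EuclideanSpace ℝ (Fin d)) (α δ : ℝ) : Prop :=
  ∀ (θ : ℕ) (R : Fin θ → Finset V), (∀ j, M.IsRRSet (R j)) →
    A θ R ∈ M.feasible ∧
      (0 < θ → ∀ y ∈ M.feasible,
        α * (M.gHat R y + M.s y) - δ ≤ M.gHat R (A θ R) + M.s (A θ R))

/-! ### The meta-algorithm

`A δ` is the gradient algorithm run with additive error parameter `δ`. -/

section algorithm

variable (L₁ L₂ ε ℓ α : ℝ)
  (A : ℝ → (θ : ℕ) → (Fin θ → Finset V) → EuclideanSpace ℝ (Fin d))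

/-- `n + λ k` -/
def total : ℝ := (Fintype.card V : ℝ) + M.lam * M.budget

/-- The number of iterations of the sampling loop. -/
def numIter : ℕ := ⌊Real.logb 2 M.total - 1⌋₊

/-- `ε' = √2 ε / 3` -/
def epsPrime : ℝ := Real.sqrt 2 * ε / 3

/-- The `i`-th guess for the lower bound. -/
def guess (i : ℕ) : ℝ := M.total / 2 ^ i

/-- The number of RR sets used in iteration `i ≥ 1`. -/
def thetaIter (i : ℕ) : ℕ :=
  ⌈(Fintype.card V : ℝ) * (2 + 2 / 3 * epsPrime ε) *
      ((Real.log (covNum M.feasible (ε / 3 / L₂ * M.guess i)) + ℓ * Real.log (Fintype.card V) +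
        Real.log 2 + Real.log (Real.logb 2 M.total)) / (epsPrime ε ^ 2 * M.guess i))⌉₊

/-- The value of `ĝ + s` at the point that `A` finds in iteration `i`, when the RR sets generated
in the sampling loop are `ξ 0, ξ 1, …`; iteration `i` uses the first `thetaIter i` of them. -/
def iterValue (ξ : ℕ → Finset V) (i : ℕ) : ℝ :=
  let R : Fin (M.thetaIter L₂ ε ℓ i) → Finset V := fun j => ξ j
  let y := A (ε * M.guess i / 3) _ R
  M.gHat R y + M.s y

/-- Iteration `i` exists and its test succeeds. -/
def Breaks (ξ : ℕ → Finset V) (i : ℕ) : Prop :=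
  1 ≤ i ∧ i ≤ M.numIter ∧
    (1 + epsPrime ε + ε / 3) * M.guess i ≤ M.iterValue L₂ ε ℓ A ξ i

open Classical in
/-- The lower bound `LB` found by the sampling loop, which stops at the first success. -/
def lowerBound (ξ : ℕ → Finset V) : ℝ :=
  if H : ∃ i, M.Breaks L₂ ε ℓ A ξ i then
    M.iterValue L₂ ε ℓ A ξ (Nat.find H) / (1 + epsPrime ε + ε / 3)
  else 1

/-- `θ⁽¹⁾` for a lower bound `LB`. -/
def theta1 (_M : CIMBS V d) (ε ℓ α LB : ℝ) : ℝ :=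
  8 * (Fintype.card V : ℝ) * Real.log (4 * (Fintype.card V : ℝ) ^ ℓ) /
    (LB * (α - ε / 3) ^ 2 * (ε ^ 2 / 9))

/-- `θ⁽²⁾` for a lower bound `LB`. -/
def theta2 (LB : ℝ) : ℝ :=
  2 * (α - ε / 3) * (Fintype.card V : ℝ) *
      Real.log (4 * (Fintype.card V : ℝ) ^ ℓ * covNum M.feasible (ε / 3 / (L₁ + L₂) * LB)) /
    ((ε / 3 - 1 / 2 * (α - ε / 3) ^ 2 * (ε / 3)) ^ 2 * LB)

/-- The number of RR sets regenerated after the loop. -/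
def thetaFinal (LB : ℝ) : ℕ :=
  ⌈max (M.theta1 ε ℓ α LB) (M.theta2 L₁ L₂ ε ℓ α LB)⌉₊

/-- The output of the meta-algorithm, when `ω.1` is the sequence of RR sets generated in the
sampling loop and `ω.2` the sequence of RR sets generated afresh after it. -/
def gradRIS (ω : (ℕ → Finset V) × (ℕ → Finset V)) : EuclideanSpace ℝ (Fin d) :=
  let LB := M.lowerBound L₂ ε ℓ A ω.1
  A (ε / 3 * LB) (M.thetaFinal L₁ L₂ ε ℓ α LB) fun j => ω.2 j

end algorithm

/-- The law of the randomness of the meta-algorithm: all RR sets are independent. -/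
def sampleLaw : Measure ((ℕ → Finset V) × (ℕ → Finset V)) :=
  (Measure.infinitePi fun _ : ℕ => M.rrLaw).prod (Measure.infinitePi fun _ : ℕ => M.rrLaw)

instance [Nonempty V] : IsProbabilityMeasure M.sampleLaw := by
  unfold sampleLaw; infer_instance

end CIMBS

end

/-! Write the objective as the mean of the estimates from single RR sets. Each estimate is
nonnegative and oscillates by at most `n`, so after shifting it by its infimum its second moment is
at most `n` times its mean; Bernstein's inequality then applies, although the estimates themselves
are not bounded by `n`. A union bound over a net of the feasible region, combined with the Lipschitz
conditions, makes the deviation bounds uniform. In each iteration of the loop they show that a value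
above `(1 + ε' + ε / 3) * max (x_i) OPT` is unlikely, so that `LB ≤ OPT` with probability
at least `1 - 1 / (2 * n ^ ℓ)`.

For the final sample let `y₀` attain the optimum on the closure of the feasible region. If the
output is worse than `(α - ε) * OPT`, then either the estimate of `y₀` is too small, or for some net
point `p` of small value the difference `ĝ(p) - (ε / 3) * ĝ(y₀)` exceeds its mean by at least
`(ε / 3 - α' ^ 2 * (ε / 3) / 2) * OPT`. Keeping only the fraction `ε / 3` of the random term `ĝ(y₀)`
keeps the second moment of this difference small enough for the sample size `θ⁽²⁾`. Given the loop,
`LB` is a constant, and the fresh RR sets are independent of it. -/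

noncomputable section

open ProbabilityTheory Metric
open scoped NNReal

section Bernstein

theorem exp_le_of_nonneg_of_lt_three {x : ℝ} (hx : 0 ≤ x) (hx3 : x < 3) :
    Real.exp x ≤ 1 + x + x ^ 2 / (2 * (1 - x / 3)) := by
  have hexp : HasSum (fun n : ℕ => x ^ n / n.factorial) (Real.exp x) := by
    rw [Real.exp_eq_exp_ℝ]
    exact NormedSpace.expSeries_div_hasSum_exp x
  have hgeom : HasSum (fun n : ℕ => x ^ 2 / 2 * (x / 3) ^ n) (x ^ 2 / 2 * (1 - x / 3)⁻¹) :=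
    (hasSum_geometric_of_lt_one (by positivity) (by linarith)).mul_left _
  have hterm (n : ℕ) : x ^ (n + 2) / ((n + 2).factorial : ℝ) ≤ x ^ 2 / 2 * (x / 3) ^ n := by
    have hfac : (2 : ℝ) * 3 ^ n ≤ ((n + 2).factorial : ℝ) := by
      have := Nat.factorial_mul_pow_le_factorial (m := 2) (n := n)
      rw [add_comm 2 n] at this
      exact_mod_cast this
    calc x ^ (n + 2) / ((n + 2).factorial : ℝ) ≤ x ^ (n + 2) / (2 * 3 ^ n) := by gcongr
      _ = x ^ 2 / 2 * (x / 3) ^ n := by rw [div_pow]; field_simp; ring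
  have htail := hasSum_le hterm ((hasSum_nat_add_iff' 2).mpr hexp) hgeom
  norm_num [Finset.sum_range_succ] at htail
  calc Real.exp x ≤ 1 + x + x ^ 2 / 2 * (1 - x / 3)⁻¹ := by linarith
    _ = 1 + x + x ^ 2 / (2 * (1 - x / 3)) := by rw [← div_div]; rfl

theorem exp_le_of_nonpos {x : ℝ} (hx : x ≤ 0) : Real.exp x ≤ 1 + x + x ^ 2 / 2 := by
  have hquad : 1 + -x + (-x) ^ 2 / 2 ≤ Real.exp (-x) :=
    Real.quadratic_le_exp_of_nonneg (neg_nonneg.2 hx)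
  have hpos : 0 < 1 + -x + (-x) ^ 2 / 2 := by nlinarith
  have hinv : Real.exp x ≤ (1 + -x + (-x) ^ 2 / 2)⁻¹ := by
    rw [← neg_neg x, Real.exp_neg, neg_neg]
    exact inv_anti₀ hpos hquad
  refine hinv.trans ((inv_le_iff_one_le_mul₀ hpos).2 ?_)
  nlinarith [sq_nonneg (x ^ 2)]

theorem exp_le_of_le_of_lt_three {x c : ℝ} (hc : 0 ≤ c) (hc3 : c < 3) (hxc : x ≤ c) :
    Real.exp x ≤ 1 + x + x ^ 2 / (2 * (1 - c / 3)) := by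
  have hpos : 0 < 1 - c / 3 := by linarith
  rcases le_total 0 x with hx | hx
  · refine (exp_le_of_nonneg_of_lt_three hx (hxc.trans_lt hc3)).trans ?_
    gcongr
  · refine (exp_le_of_nonpos hx).trans ?_
    gcongr
    linarith

variable {Ω : Type*} [MeasurableSpace Ω] {μ : Measure Ω}

theorem mgf_le_exp_of_le [IsProbabilityMeasure μ] {X : Ω → ℝ} {b l : ℝ} (hX : MemLp X 2 μ)
    (hXb : ∀ᵐ ω ∂μ, X ω ≤ b) (hb : 0 ≤ b) (hl : 0 ≤ l) (hlb : l * b < 3) :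
    mgf X μ l ≤
      Real.exp (l * (∫ ω, X ω ∂μ) + l ^ 2 / (2 * (1 - l * b / 3)) * ∫ ω, X ω ^ 2 ∂μ) := by
  set q := l ^ 2 / (2 * (1 - l * b / 3))
  have hlin : Integrable (fun ω => l * X ω) μ := (hX.integrable one_le_two).const_mul l
  have hsq : Integrable (fun ω => q * X ω ^ 2) μ := hX.integrable_sq.const_mul q
  have hlinsq : Integrable (fun ω => l * X ω + q * X ω ^ 2) μ := hlin.add hsq
  have hpt : ∀ᵐ ω ∂μ, Real.exp (l * X ω) ≤ l * X ω + q * X ω ^ 2 + 1 := by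
    filter_upwards [hXb] with ω hω
    have := exp_le_of_le_of_lt_three (by positivity) hlb (mul_le_mul_of_nonneg_left hω hl)
    rw [mul_pow, mul_div_right_comm] at this
    linarith
  calc mgf X μ l ≤ ∫ ω, (l * X ω + q * X ω ^ 2 + 1) ∂μ :=
        integral_mono_ae (integrable_exp_mul_of_le l b hl hX.1.aemeasurable hXb)
          (hlinsq.add (integrable_const 1)) hpt
    _ = l * (∫ ω, X ω ∂μ) + q * (∫ ω, X ω ^ 2 ∂μ) + 1 := by
        rw [integral_add hlinsq (integrable_const 1), integral_add hlin hsq,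
          integral_const_mul, integral_const_mul]
        simp
    _ ≤ _ := Real.add_one_le_exp _

/-- Bernstein's inequality: only an upper bound on the variables is needed, and their second
moments need not be centred. -/
theorem measureReal_sum_ge_le_exp_of_iIndepFun {ι : Type*} {X : ι → Ω → ℝ} {s : Finset ι}
    {b t v : ℝ} (hindep : iIndepFun X μ) (hX : ∀ i, MemLp (X i) 2 μ)
    (hXb : ∀ i, ∀ᵐ ω ∂μ, X i ω ≤ b) (hb : 0 ≤ b) (hv : 0 < v)
    (hvar : ∑ i ∈ s, ∫ ω, X i ω ^ 2 ∂μ ≤ v) (ht : 0 ≤ t) :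
    μ.real {ω | ∑ i ∈ s, (∫ ω, X i ω ∂μ) + t ≤ ∑ i ∈ s, X i ω} ≤
      Real.exp (-(t ^ 2 / (2 * (v + b * t / 3)))) := by
  have := hindep.isProbabilityMeasure
  have : 0 < v + b * t / 3 := by positivity
  set l := t / (v + b * t / 3) with hl_def
  have hl : 0 ≤ l := by positivity
  have hlb : 1 - l * b / 3 = v / (v + b * t / 3) := by rw [hl_def]; field_simp; ring
  have hlb_pos : 0 < 1 - l * b / 3 := by rw [hlb]; positivity
  set q := l ^ 2 / (2 * (1 - l * b / 3)) with hq_def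
  have hsum_le : ∀ᵐ ω ∂μ, (∑ i ∈ s, X i) ω ≤ s.card • b := by
    filter_upwards [(Filter.eventually_all_finset s).2 fun i _ => hXb i] with ω hω
    rw [Finset.sum_apply]
    exact Finset.sum_le_card_nsmul s _ b hω
  have hsum_meas : AEMeasurable (∑ i ∈ s, X i) μ :=
    Finset.aemeasurable_sum s fun i _ => (hX i).1.aemeasurable
  have hchernoff := measure_ge_le_exp_mul_mgf (∑ i ∈ s, (∫ ω, X i ω ∂μ) + t) hl
    (integrable_exp_mul_of_le l _ hl hsum_meas hsum_le)
  rw [hindep.mgf_sum₀ (fun i => (hX i).1.aemeasurable) s] at hchernoff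
  simp only [Finset.sum_apply] at hchernoff
  calc _ ≤ _ := hchernoff
    _ ≤ Real.exp (-l * (∑ i ∈ s, (∫ ω, X i ω ∂μ) + t)) *
          ∏ i ∈ s, Real.exp (l * (∫ ω, X i ω ∂μ) + q * ∫ ω, X i ω ^ 2 ∂μ) := by
        gcongr with i _
        exacts [fun _ _ => mgf_nonneg,
          mgf_le_exp_of_le (hX i) (hXb i) hb hl (by linarith)]
    _ = Real.exp (-(l * t) + q * ∑ i ∈ s, ∫ ω, X i ω ^ 2 ∂μ) := by
        rw [← Real.exp_sum, ← Real.exp_add, Finset.sum_add_distrib, ← Finset.mul_sum,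
          ← Finset.mul_sum]
        ring_nf
    _ ≤ Real.exp (-(l * t) + q * v) := by gcongr
    _ = Real.exp (-(t ^ 2 / (2 * (v + b * t / 3)))) := by
        rw [hq_def, hlb, hl_def]
        congr 1
        field_simp
        ring

end Bernstein

section SampleAverage

variable {X : Type*}

/-- The empirical mean of `f` over the sample `R`; it is `0` for an empty sample. -/
def sampleAverage {θ : ℕ} (R : Fin θ → X) (f : X → ℝ) : ℝ := (∑ j, f (R j)) / θ

variable {θ : ℕ} {R : Fin θ → X}

theorem sampleAverage_mono {f f' : X → ℝ} (h : ∀ j, f (R j) ≤ f' (R j)) :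
    sampleAverage R f ≤ sampleAverage R f' :=
  div_le_div_of_nonneg_right (Finset.sum_le_sum fun j _ => h j) θ.cast_nonneg

theorem sampleAverage_congr {f f' : X → ℝ} (h : ∀ j, f (R j) = f' (R j)) :
    sampleAverage R f = sampleAverage R f' := by
  simp only [sampleAverage, h]

theorem sampleAverage_add (f f' : X → ℝ) :
    sampleAverage R (fun x => f x + f' x) = sampleAverage R f + sampleAverage R f' := by
  simp only [sampleAverage, Finset.sum_add_distrib, add_div]

theorem sampleAverage_const_mul (c : ℝ) (f : X → ℝ) :
    sampleAverage R (fun x => c * f x) = c * sampleAverage R f := by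
  simp only [sampleAverage, ← Finset.mul_sum, mul_div_assoc]

theorem sampleAverage_const (hθ : 0 < θ) (c : ℝ) : sampleAverage R (fun _ => c) = c := by
  simp [sampleAverage, hθ.ne']

variable [MeasurableSpace X] {μ : Measure X} [IsProbabilityMeasure μ]

theorem measureReal_sampleAverage_ge_le_exp_of_memLp {w : X → ℝ} {b c t v : ℝ} (hw : MemLp w 2 μ)
    (hwb : ∀ x, w x - c ≤ b) (hb : 0 ≤ b) (hv : 0 < v) (hvar : ∫ x, (w x - c) ^ 2 ∂μ ≤ v)
    (ht : 0 ≤ t) :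
    (Measure.pi fun _ : Fin θ => μ).real {R | (∫ x, w x ∂μ) + t ≤ sampleAverage R w} ≤
      Real.exp (-(θ * t ^ 2 / (2 * (v + b * t / 3)))) := by
  rcases θ.eq_zero_or_pos with rfl | hθ
  · simp
  have hθ' : (0 : ℝ) < θ := by exact_mod_cast hθ
  have hwc : MemLp (fun x => w x - c) 2 μ := hw.sub (memLp_const c)
  have heval (j : Fin θ) : MeasurePreserving (Function.eval j) (Measure.pi fun _ : Fin θ => μ) μ :=
    measurePreserving_eval (fun _ => μ) j
  have hmean (j : Fin θ) : ∫ R, (w (R j) - c) ∂(Measure.pi fun _ : Fin θ => μ) =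
      (∫ x, w x ∂μ) - c := by
    rw [integral_comp_eval (μ := fun _ : Fin θ => μ) (f := fun x => w x - c) hwc.1,
      integral_sub (hw.integrable one_le_two) (integrable_const c)]
    simp
  have hmoment (j : Fin θ) : ∫ R, (w (R j) - c) ^ 2 ∂(Measure.pi fun _ : Fin θ => μ) ≤ v :=
    (integral_comp_eval (μ := fun _ : Fin θ => μ) (f := fun x => (w x - c) ^ 2)
      (hwc.1.pow 2)).trans_le hvar
  have hbern := measureReal_sum_ge_le_exp_of_iIndepFun (s := Finset.univ) (b := b) (t := θ * t)
    (v := θ * v)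
    (iIndepFun_pi (μ := fun _ : Fin θ => μ) (X := fun _ x => w x - c)
      fun _ => hwc.1.aemeasurable)
    (fun j => hwc.comp_measurePreserving (heval j)) (fun _ => ae_of_all _ fun R => hwb _) hb
    (by positivity)
    ((Finset.sum_le_sum fun j _ => hmoment j).trans_eq (by simp)) (by positivity)
  refine (measureReal_mono fun R hR => ?_).trans (hbern.trans_eq ?_)
  · simp only [Set.mem_ofPred_eq, sampleAverage, le_div_iff₀ hθ'] at hR
    simp only [Set.mem_ofPred_eq, hmean, Finset.sum_sub_distrib, Finset.sum_const,
      Finset.card_univ, Fintype.card_fin, nsmul_eq_mul]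
    linarith
  · congr 2
    field_simp

end SampleAverage

section Payoff

variable {X : Type*} [MeasurableSpace X]

/-- A nonnegative payoff with oscillation at most `n`. It may be much larger than `n`, but shifting
it by its infimum leaves a second moment of at most `n` times its mean. -/
structure IsPayoff (f : X → ℝ) (n : ℝ) : Prop where
  measurable : Measurable f
  nonneg : ∀ x, 0 ≤ f x
  le_add : ∀ x x', f x ≤ f x' + n

namespace IsPayoff

variable {f f₀ : X → ℝ} {n : ℝ}

theorem exists_floor [Nonempty X] (hf : IsPayoff f n) :
    ∃ m, 0 ≤ m ∧ ∀ x, m ≤ f x ∧ f x - m ≤ n := by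
  have hbdd : BddBelow (Set.range f) := ⟨0, Set.forall_mem_range.2 hf.nonneg⟩
  refine ⟨⨅ x, f x, le_ciInf hf.nonneg, fun x => ⟨ciInf_le hbdd x, ?_⟩⟩
  have : f x - n ≤ ⨅ x', f x' := le_ciInf fun x' => sub_le_iff_le_add.2 (hf.le_add x x')
  linarith

variable {μ : Measure X} [IsProbabilityMeasure μ]

theorem memLp (hf : IsPayoff f n) : MemLp f 2 μ := by
  obtain ⟨x₀⟩ := μ.nonempty_of_neZero
  refine MemLp.of_bound hf.measurable.aestronglyMeasurable (f x₀ + n) (ae_of_all _ fun x => ?_)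
  rw [Real.norm_of_nonneg (hf.nonneg x)]
  exact hf.le_add x x₀

theorem integrable (hf : IsPayoff f n) : Integrable f μ :=
  hf.memLp.integrable one_le_two

theorem integral_sub_sq_le {m : ℝ} (hf : IsPayoff f n) (hm : 0 ≤ m)
    (hfm : ∀ x, m ≤ f x ∧ f x - m ≤ n) : ∫ x, (f x - m) ^ 2 ∂μ ≤ n * ∫ x, f x ∂μ := by
  have hfm_memLp : MemLp (fun x => f x - m) 2 μ := hf.memLp.sub (memLp_const m)
  rw [← integral_const_mul]
  refine integral_mono hfm_memLp.integrable_sq (hf.integrable.const_mul n) fun x => ?_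
  nlinarith [hfm x, mul_nonneg (sub_nonneg.2 (hfm x).1) (sub_nonneg.2 (hfm x).2)]

theorem integral_sub_mul_sq_le {b m m₀ : ℝ} (hf : IsPayoff f n) (hf₀ : IsPayoff f₀ n)
    (hb : 0 ≤ b) (hm : 0 ≤ m) (hfm : ∀ x, m ≤ f x ∧ f x - m ≤ n) (hm₀ : 0 ≤ m₀)
    (hfm₀ : ∀ x, m₀ ≤ f₀ x ∧ f₀ x - m₀ ≤ n) :
    ∫ x, ((f x - m) - b * (f₀ x - m₀)) ^ 2 ∂μ ≤
      n * ((∫ x, f x ∂μ) + b ^ 2 * ∫ x, f₀ x ∂μ) := by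
  have hmem : MemLp (fun x => f x - m) 2 μ := hf.memLp.sub (memLp_const m)
  have hmem₀ : MemLp (fun x => f₀ x - m₀) 2 μ := hf₀.memLp.sub (memLp_const m₀)
  have hint₀ : Integrable (fun x => b ^ 2 * (f₀ x - m₀) ^ 2) μ :=
    hmem₀.integrable_sq.const_mul _
  calc ∫ x, ((f x - m) - b * (f₀ x - m₀)) ^ 2 ∂μ
      ≤ ∫ x, ((f x - m) ^ 2 + b ^ 2 * (f₀ x - m₀) ^ 2) ∂μ := by
        refine integral_mono (hmem.sub (hmem₀.const_mul b)).integrable_sq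
          (hmem.integrable_sq.add hint₀) fun x => ?_
        have hcross : 0 ≤ b * ((f x - m) * (f₀ x - m₀)) :=
          mul_nonneg hb (mul_nonneg (sub_nonneg.2 (hfm x).1) (sub_nonneg.2 (hfm₀ x).1))
        nlinarith only [hcross]
    _ ≤ n * (∫ x, f x ∂μ) + b ^ 2 * (n * ∫ x, f₀ x ∂μ) := by
        rw [integral_add hmem.integrable_sq hint₀, integral_const_mul]
        gcongr
        exacts [hf.integral_sub_sq_le hm hfm, hf₀.integral_sub_sq_le hm₀ hfm₀]
    _ = n * ((∫ x, f x ∂μ) + b ^ 2 * ∫ x, f₀ x ∂μ) := by ring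

variable {θ : ℕ} {a b B : ℝ}

theorem measureReal_sampleAverage_sub_ge_le_exp (hf : IsPayoff f n) (hf₀ : IsPayoff f₀ n)
    (hn : 0 < n) (hb : 0 ≤ b) (hB : 0 < B) (hfB : (∫ x, f x ∂μ) + b ^ 2 * ∫ x, f₀ x ∂μ ≤ B)
    (ha : 0 ≤ a) :
    (Measure.pi fun _ : Fin θ => μ).real
        {R | (∫ x, f x ∂μ) - b * (∫ x, f₀ x ∂μ) + a ≤
          sampleAverage R f - b * sampleAverage R f₀} ≤
      Real.exp (-(θ * a ^ 2 / (2 * n * (B + a / 3)))) := by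
  have := μ.nonempty_of_neZero
  obtain ⟨m, hm, hfm⟩ := hf.exists_floor
  obtain ⟨m₀, hm₀, hfm₀⟩ := hf₀.exists_floor
  have hbf₀ : MemLp (fun x => b * f₀ x) 2 μ := hf₀.memLp.const_mul b
  have hshift (x : X) :
      f x - b * f₀ x - (m - b * m₀) = (f x - m) - b * (f₀ x - m₀) := by ring
  have hvar : ∫ x, (f x - b * f₀ x - (m - b * m₀)) ^ 2 ∂μ ≤ n * B := by
    simp only [hshift]
    exact (hf.integral_sub_mul_sq_le hf₀ hb hm hfm hm₀ hfm₀).trans (by gcongr)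
  have hbound (x : X) : f x - b * f₀ x - (m - b * m₀) ≤ n := by
    rw [hshift]
    linarith [hfm x, mul_nonneg hb (sub_nonneg.2 (hfm₀ x).1)]
  have hbern := measureReal_sampleAverage_ge_le_exp_of_memLp (θ := θ) (hf.memLp.sub hbf₀) hbound
    hn.le (mul_pos hn hB) hvar ha
  have hmean : ∫ x, (f - fun x => b * f₀ x) x ∂μ = (∫ x, f x ∂μ) - b * ∫ x, f₀ x ∂μ := by
    rw [integral_sub' hf.integrable (hbf₀.integrable one_le_two), integral_const_mul]
  have havg (R : Fin θ → X) : sampleAverage R (f - fun x => b * f₀ x) =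
      sampleAverage R f - b * sampleAverage R f₀ := by
    simp only [sampleAverage, Pi.sub_apply, Finset.sum_sub_distrib, ← Finset.mul_sum]
    ring
  simp only [hmean, havg] at hbern
  exact hbern.trans_eq (by congr 3; ring)

theorem measureReal_sampleAverage_ge_le_exp (hf : IsPayoff f n) (hn : 0 < n) (hB : 0 < B)
    (hfB : ∫ x, f x ∂μ ≤ B) (ha : 0 ≤ a) :
    (Measure.pi fun _ : Fin θ => μ).real {R | (∫ x, f x ∂μ) + a ≤ sampleAverage R f} ≤
      Real.exp (-(θ * a ^ 2 / (2 * n * (B + a / 3)))) := by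
  simpa using hf.measureReal_sampleAverage_sub_ge_le_exp (θ := θ) hf hn le_rfl hB
    (by simpa using hfB) ha

theorem measureReal_sampleAverage_sub_ge_le_exp_of_integral_le {α e t : ℝ} (hf : IsPayoff f n)
    (hf₀ : IsPayoff f₀ n) (hn : 0 < n) (he : 0 < e) (heα : 3 * e < α) (hα : α ≤ 1) (ht : 0 ≤ t)
    (hte : t ≤ e) (hO : 0 < ∫ x, f₀ x ∂μ) (hfO : ∫ x, f x ∂μ ≤ (α - 2 * e) * ∫ x, f₀ x ∂μ) :
    (Measure.pi fun _ : Fin θ => μ).real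
        {R | (∫ x, f x ∂μ) - e * (∫ x, f₀ x ∂μ) + t * (∫ x, f₀ x ∂μ) ≤
          sampleAverage R f - e * sampleAverage R f₀} ≤
      Real.exp (-(θ * t ^ 2 * (∫ x, f₀ x ∂μ) / (2 * n * (α - e)))) := by
  set O := ∫ x, f₀ x ∂μ with hO_def
  have hαe : 0 < α - e := by linarith
  have hB : 0 < (α - 2 * e + e ^ 2) * O := by
    have : 0 < α - 2 * e := by linarith
    positivity
  have hproxy : (α - 2 * e + e ^ 2) * O + t * O / 3 ≤ (α - e) * O := by
    have : α - 2 * e + e ^ 2 + t / 3 ≤ α - e := by nlinarith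
    nlinarith
  refine (hf.measureReal_sampleAverage_sub_ge_le_exp hf₀ hn he.le hB
    (by rw [← hO_def]; linarith) (by positivity)).trans ?_
  calc Real.exp _ ≤ Real.exp (-(θ * (t * O) ^ 2 / (2 * n * ((α - e) * O)))) := by gcongr
    _ = _ := by congr 2; field_simp

theorem measureReal_sampleAverage_le_le_exp (hf : IsPayoff f n) (hn : 0 < n) (hB : 0 < B)
    (hfB : ∫ x, f x ∂μ ≤ B) (ha : 0 ≤ a) :
    (Measure.pi fun _ : Fin θ => μ).real {R | sampleAverage R f ≤ (∫ x, f x ∂μ) - a} ≤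
      Real.exp (-(θ * a ^ 2 / (2 * n * B))) := by
  have := μ.nonempty_of_neZero
  obtain ⟨m, hm, hfm⟩ := hf.exists_floor
  have hvar : ∫ x, (-1 * f x - -m) ^ 2 ∂μ ≤ n * B :=
    calc ∫ x, (-1 * f x - -m) ^ 2 ∂μ = ∫ x, (f x - m) ^ 2 ∂μ := by congr! 2; ring
      _ ≤ n * ∫ x, f x ∂μ := hf.integral_sub_sq_le hm hfm
      _ ≤ n * B := by gcongr
  have hbern := measureReal_sampleAverage_ge_le_exp_of_memLp (θ := θ) (hf.memLp.const_mul (-1))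
    (fun x => by linarith [(hfm x).1]) le_rfl (mul_pos hn hB) hvar ha
  refine (measureReal_mono fun R hR => ?_).trans (hbern.trans_eq (by ring_nf))
  simp only [Set.mem_ofPred_eq, sampleAverage_const_mul, integral_const_mul] at hR ⊢
  linarith

end IsPayoff

end Payoff

section PayoffFamily

variable {X E : Type*} [MeasurableSpace X] [PseudoMetricSpace E]

/-- A family of payoffs of oscillation at most `n`, indexed by the strategies in `K` and
`L`-Lipschitz in the strategy for each fixed sample point. -/
structure IsPayoffFamily (F : E → X → ℝ) (K : Set E) (n : ℝ) (L : ℝ≥0) : Prop where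
  isPayoff : ∀ y ∈ K, IsPayoff (F y) n
  lipschitzOnWith : ∀ x, LipschitzOnWith L (fun y => F y x) K

namespace IsPayoffFamily

variable {F : E → X → ℝ} {K : Set E} {n : ℝ} {L L₁ r : ℝ≥0} {N : Finset E} {θ : ℕ}

theorem lipschitzOnWith_sampleAverage (hF : IsPayoffFamily F K n L) (R : Fin θ → X) :
    LipschitzOnWith L (fun y => sampleAverage R (F y)) K := by
  refine LipschitzOnWith.of_le_add_mul L fun y hy p hp => ?_
  rcases θ.eq_zero_or_pos with rfl | hθ
  · simp only [sampleAverage, Nat.cast_zero, div_zero]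
    positivity
  calc sampleAverage R (F y) ≤ sampleAverage R (fun x => F p x + L * dist y p) :=
        sampleAverage_mono fun j => (hF.lipschitzOnWith (R j)).le_add_mul hy hp
    _ = sampleAverage R (F p) + L * dist y p := by
        rw [sampleAverage_add, sampleAverage_const hθ]

variable {μ : Measure X}

theorem lipschitzOnWith_integral [IsProbabilityMeasure μ] (hF : IsPayoffFamily F K n L) :
    LipschitzOnWith L (fun y => ∫ x, F y x ∂μ) K := by
  refine LipschitzOnWith.of_le_add_mul L fun y hy p hp => ?_
  have hp_int : Integrable (F p) μ := (hF.isPayoff p hp).integrable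
  calc ∫ x, F y x ∂μ ≤ ∫ x, (F p x + L * dist y p) ∂μ :=
        integral_mono (hF.isPayoff y hy).integrable (hp_int.add (integrable_const _))
          fun x => (hF.lipschitzOnWith x).le_add_mul hy hp
    _ = (∫ x, F p x ∂μ) + L * dist y p := by
        rw [integral_add hp_int (integrable_const _)]
        simp

/-- A sample for which a point `α`-competitive with `y₀` up to `δ` is far from optimal either
underestimates `y₀` or shows the bad deviation at a net point. The comparison with `y₀` enters the
deviation only with the factor `e`, which keeps its variance proxy below `(α - e) * O`. -/
theorem sampleAverage_le_or_exists_of_value_lt {α e δ : ℝ} (hF : IsPayoffFamily F K n L)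
    (hF₁ : LipschitzOnWith L₁ (fun y => ∫ x, F y x ∂μ) K) (hNK : ↑N ⊆ K) (hN : IsCover r K ↑N)
    {y₀ y : E} {R : Fin θ → X} (hy : y ∈ K) (he : e ≤ α) (hδ : δ ≤ e * ∫ x, F y₀ x ∂μ)
    (hr : (L₁ + L) * r ≤ e * ∫ x, F y₀ x ∂μ)
    (happrox : α * sampleAverage R (F y₀) - δ ≤ sampleAverage R (F y))
    (hlt : ∫ x, F y x ∂μ < (α - 3 * e) * ∫ x, F y₀ x ∂μ) :
    sampleAverage R (F y₀) ≤ (∫ x, F y₀ x ∂μ) - (α - e) * e / 2 * (∫ x, F y₀ x ∂μ) ∨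
      ∃ p ∈ N, ∫ x, F p x ∂μ ≤ (α - 2 * e) * (∫ x, F y₀ x ∂μ) ∧
        (∫ x, F p x ∂μ) - e * (∫ x, F y₀ x ∂μ) +
            (e - (α - e) ^ 2 * e / 2) * (∫ x, F y₀ x ∂μ) ≤
          sampleAverage R (F p) - e * sampleAverage R (F y₀) := by
  refine or_iff_not_imp_left.2 fun hy₀ => ?_
  rw [not_le] at hy₀
  obtain ⟨p, hp, hyp⟩ := hN hy
  have hdist : dist y p ≤ r := edist_le_coe.1 hyp
  have hvalue := hF₁.le_add_mul (hNK hp) hy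
  have hestimate := (hF.lipschitzOnWith_sampleAverage R).le_add_mul hy (hNK hp)
  rw [dist_comm] at hvalue
  have hL₁r : L₁ * dist y p ≤ L₁ * r := by gcongr
  have hLr : L * dist y p ≤ L * r := by gcongr
  have hLr₀ : (0 : ℝ) ≤ L * r := by positivity
  have hscaled := mul_le_mul_of_nonneg_left hy₀.le (sub_nonneg.2 he)
  exact ⟨p, hp, by linarith, by linarith⟩

variable [IsProbabilityMeasure μ]

theorem measureReal_exists_sampleAverage_ge_le {a B : ℝ} (hF : IsPayoffFamily F K n L)
    (hn : 0 < n) (hNK : ↑N ⊆ K) (hN : IsCover r K ↑N) (hB : 0 < B)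
    (hFB : ∀ y ∈ K, ∫ x, F y x ∂μ ≤ B) (ha : 0 ≤ a) :
    (Measure.pi fun _ : Fin θ => μ).real {R | ∃ y ∈ K, B + a + L * r ≤ sampleAverage R (F y)} ≤
      N.card * Real.exp (-(θ * a ^ 2 / (2 * n * (B + a / 3)))) := by
  have hsub : {R : Fin θ → X | ∃ y ∈ K, B + a + L * r ≤ sampleAverage R (F y)} ⊆
      ⋃ p ∈ N, {R | (∫ x, F p x ∂μ) + a ≤ sampleAverage R (F p)} := by
    rintro R ⟨y, hy, hyR⟩
    obtain ⟨p, hp, hyp⟩ := hN hy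
    have hdist : dist y p ≤ r := edist_le_coe.1 hyp
    have hLip := (hF.lipschitzOnWith_sampleAverage R).le_add_mul hy (hNK hp)
    have hLr : L * dist y p ≤ L * r := by gcongr
    refine Set.mem_biUnion hp ?_
    simp only [Set.mem_ofPred_eq]
    linarith [hFB p (hNK hp)]
  calc _ ≤ _ := measureReal_mono hsub (measure_ne_top _ _)
    _ ≤ _ := measureReal_biUnion_finset_le _ _
    _ ≤ N.card • Real.exp (-(θ * a ^ 2 / (2 * n * (B + a / 3)))) :=
        Finset.sum_le_card_nsmul _ _ _ fun p hp =>
          (hF.isPayoff p (hNK hp)).measureReal_sampleAverage_ge_le_exp hn hB (hFB p (hNK hp)) ha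
    _ = _ := nsmul_eq_mul _ _

theorem measureReal_exists_value_lt_le {α e δ : ℝ} (hF : IsPayoffFamily F K n L) (hn : 0 < n)
    (hF₁ : LipschitzOnWith L₁ (fun y => ∫ x, F y x ∂μ) K) (hNK : ↑N ⊆ K) (hN : IsCover r K ↑N)
    {y₀ : E} (hy₀ : y₀ ∈ K) (hO : 0 < ∫ x, F y₀ x ∂μ) (he : 0 < e) (heα : 3 * e < α)
    (hα : α ≤ 1) (hδ : δ ≤ e * ∫ x, F y₀ x ∂μ) (hr : (L₁ + L) * r ≤ e * ∫ x, F y₀ x ∂μ) :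
    (Measure.pi fun _ : Fin θ => μ).real
        {R | ∃ y ∈ K, α * sampleAverage R (F y₀) - δ ≤ sampleAverage R (F y) ∧
          ∫ x, F y x ∂μ < (α - 3 * e) * ∫ x, F y₀ x ∂μ} ≤
      Real.exp (-(θ * ((α - e) * e / 2) ^ 2 * (∫ x, F y₀ x ∂μ) / (2 * n))) +
        N.card * Real.exp (-(θ * (e - (α - e) ^ 2 * e / 2) ^ 2 * (∫ x, F y₀ x ∂μ) /
          (2 * n * (α - e)))) := by
  set O := ∫ x, F y₀ x ∂μ
  set e₂ := e - (α - e) ^ 2 * e / 2 with he₂_def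
  have hαe : 0 < α - e := by linarith
  have hae : (α - e) ^ 2 ≤ 1 := by nlinarith
  have he₂ : 0 ≤ e₂ := by nlinarith
  have he₂e : e₂ ≤ e := by nlinarith [sq_nonneg (α - e)]
  let badMean : Set (Fin θ → X) := {R | sampleAverage R (F y₀) ≤ O - (α - e) * e / 2 * O}
  let badNet (p : E) : Set (Fin θ → X) := {R | ∫ x, F p x ∂μ ≤ (α - 2 * e) * O ∧
    (∫ x, F p x ∂μ) - e * O + e₂ * O ≤ sampleAverage R (F p) - e * sampleAverage R (F y₀)}
  have hMean : (Measure.pi fun _ : Fin θ => μ).real badMean ≤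
      Real.exp (-(θ * ((α - e) * e / 2) ^ 2 * O / (2 * n))) := by
    refine ((hF.isPayoff y₀ hy₀).measureReal_sampleAverage_le_le_exp hn hO le_rfl
      (by positivity)).trans_eq ?_
    congr 2
    field_simp
  have hNet (p : E) (hp : p ∈ N) : (Measure.pi fun _ : Fin θ => μ).real (badNet p) ≤
      Real.exp (-(θ * e₂ ^ 2 * O / (2 * n * (α - e)))) := by
    by_cases hpO : ∫ x, F p x ∂μ ≤ (α - 2 * e) * O
    · refine (measureReal_mono fun R hR => hR.2).trans ?_
      exact (hF.isPayoff p (hNK hp)).measureReal_sampleAverage_sub_ge_le_exp_of_integral_le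
        (hF.isPayoff y₀ hy₀) hn he heα hα he₂ he₂e hO hpO
    · have : badNet p = ∅ := Set.eq_empty_of_forall_notMem fun R hR => hpO hR.1
      rw [this, measureReal_empty]
      positivity
  have hsub : {R : Fin θ → X | ∃ y ∈ K, α * sampleAverage R (F y₀) - δ ≤ sampleAverage R (F y) ∧
      ∫ x, F y x ∂μ < (α - 3 * e) * O} ⊆ badMean ∪ ⋃ p ∈ N, badNet p := by
    rintro R ⟨y, hy, happrox, hlt⟩
    rcases hF.sampleAverage_le_or_exists_of_value_lt hF₁ hNK hN hy (by linarith) hδ hr happrox hlt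
      with h | ⟨p, hp, h⟩
    exacts [Or.inl h, Or.inr (Set.mem_biUnion hp h)]
  calc _ ≤ _ := measureReal_mono hsub (measure_ne_top _ _)
    _ ≤ _ := measureReal_union_le _ _
    _ ≤ _ := by
      gcongr
      refine (measureReal_biUnion_finset_le _ _).trans ?_
      simpa using Finset.sum_le_card_nsmul _ _ _ hNet

end IsPayoffFamily

end PayoffFamily

section Covering

theorem exists_isCover_encard_eq_externalCoveringNumber {X : Type*} [PseudoEMetricSpace X]
    (r : ℝ≥0) (P : Set X) : ∃ C, IsCover r P C ∧ C.encard = externalCoveringNumber r P := by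
  have : Nonempty {C : Set X // IsCover r P C} := ⟨⟨P, .rfl⟩⟩
  have hmem := ciInf_mem fun C : {C : Set X // IsCover r P C} => C.1.encard
  obtain ⟨⟨C, hC⟩, hcard⟩ := hmem
  exact ⟨C, hC, by rw [externalCoveringNumber, iInf_subtype']; exact hcard⟩

theorem externalCoveringNumber_ne_top_of_isCompact_closure {X : Type*} [PseudoEMetricSpace X]
    {r : ℝ≥0} (hr : r ≠ 0) {P : Set X} (hP : IsCompact (closure P)) :
    externalCoveringNumber r P ≠ ⊤ := by
  obtain ⟨N, -, hN, hcov⟩ := exists_finite_isCover_of_isCompact_closure hr hP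
  exact (hcov.externalCoveringNumber_le_encard.trans_lt hN.encard_lt_top).ne

theorem exists_mem_forall_dist_le_of_isComplete_of_convex {H : Type*} [NormedAddCommGroup H]
    [InnerProductSpace ℝ H] {K : Set H} (hne : K.Nonempty) (hcomp : IsComplete K)
    (hconv : Convex ℝ K) (u : H) : ∃ v ∈ K, ∀ w ∈ K, dist w v ≤ dist w u := by
  obtain ⟨v, hv, hmin⟩ := exists_norm_eq_iInf_of_complete_convex hne hcomp hconv u
  refine ⟨v, hv, fun w hw => ?_⟩
  have hobtuse := (norm_eq_iInf_iff_real_inner_le_zero hconv hv).1 hmin w hw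
  rw [real_inner_comm] at hobtuse
  have hexpand : ‖w - u‖ ^ 2 = ‖w - v‖ ^ 2 - 2 * inner ℝ (w - v) (u - v) + ‖u - v‖ ^ 2 := by
    rw [← norm_sub_sq_real, sub_sub_sub_cancel_right]
  rw [dist_eq_norm, dist_eq_norm]
  exact le_of_sq_le_sq (by nlinarith [sq_nonneg ‖u - v‖]) (norm_nonneg _)

variable {d : ℕ} {P : Set (EuclideanSpace ℝ (Fin d))} {r : ℝ}

/-- Net points outside a convex set can be moved into its closure by the metric projection, which
does not increase distances to points of the set. -/
theorem exists_isCover_closure_card_le_covNum (hb : Bornology.IsBounded P) (hconv : Convex ℝ P)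
    (hne : P.Nonempty) (hr : 0 < r) :
    ∃ N : Finset (EuclideanSpace ℝ (Fin d)), ↑N ⊆ closure P ∧
      IsCover r.toNNReal (closure P) (N : Set (EuclideanSpace ℝ (Fin d))) ∧
      (N.card : ℝ) ≤ covNum P r := by
  classical
  obtain ⟨C, hC, hcard⟩ := exists_isCover_encard_eq_externalCoveringNumber r.toNNReal P
  have hCfin : C.Finite := Set.encard_ne_top_iff.1 <| hcard ▸
    externalCoveringNumber_ne_top_of_isCompact_closure (by simpa using hr) hb.isCompact_closure
  choose proj hproj_mem hproj using exists_mem_forall_dist_le_of_isComplete_of_convex hne.closure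
    isClosed_closure.isComplete hconv.closure
  refine ⟨hCfin.toFinset.image proj, ?_, ?_, ?_⟩
  · rw [Finset.coe_image, Set.image_subset_iff]
    exact fun u _ => hproj_mem u
  · refine IsCover.closure (Finset.finite_toSet _).isClosed fun y hy => ?_
    obtain ⟨u, hu, hyu⟩ := hC hy
    refine ⟨proj u, by simpa using ⟨u, hu, rfl⟩, edist_le_coe.2 ?_⟩
    exact (hproj u y (subset_closure hy)).trans (edist_le_coe.1 hyu)
  · rw [covNum, ← hcard, hCfin.encard_eq_coe_toFinset_card, ENat.toNat_natCast]
    exact_mod_cast Finset.card_image_le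

theorem one_le_covNum (hb : Bornology.IsBounded P) (hne : P.Nonempty) (hr : 0 < r) :
    1 ≤ covNum P r := by
  have hfin := externalCoveringNumber_ne_top_of_isCompact_closure (r := r.toNNReal)
    (by simpa using hr) hb.isCompact_closure
  have hpos : 1 ≤ (externalCoveringNumber r.toNNReal P).toNat := by
    rw [Nat.one_le_iff_ne_zero, Ne, ENat.toNat_eq_zero, not_or]
    exact ⟨(externalCoveringNumber_pos_iff.2 hne).ne', hfin⟩
  rw [covNum]
  exact_mod_cast hpos

end Covering

section Sampling

theorem mul_exp_neg_le_one_div {q D y : ℝ} (hq : 0 < q) (hD : 0 < D)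
    (hy : Real.log (D * q) ≤ y) : q * Real.exp (-y) ≤ 1 / D := by
  calc q * Real.exp (-y) ≤ q * Real.exp (-Real.log (D * q)) := by gcongr
    _ = 1 / D := by
      rw [Real.exp_neg, Real.exp_log (mul_pos hD hq)]
      field_simp

variable {X Y : Type*} [MeasurableSpace X] [MeasurableSpace Y]

theorem one_sub_le_measureReal_of_compl_subset_union {μ : Measure X} [IsProbabilityMeasure μ]
    {s t u : Set X} (h : sᶜ ⊆ t ∪ u) : 1 - (μ.real t + μ.real u) ≤ μ.real s := by
  have huniv : Set.univ ⊆ s ∪ (t ∪ u) := fun x _ => or_iff_not_imp_left.2 fun hx => h hx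
  have hsum : 1 ≤ μ.real s + (μ.real t + μ.real u) :=
    calc 1 = μ.real Set.univ := probReal_univ.symm
      _ ≤ μ.real (s ∪ (t ∪ u)) := measureReal_mono huniv
      _ ≤ μ.real s + μ.real (t ∪ u) := measureReal_union_le _ _
      _ ≤ _ := by gcongr; exact measureReal_union_le _ _
  linarith

theorem infinitePi_real_setOf_prefix_mem (μ : Measure X) [IsProbabilityMeasure μ] {θ : ℕ}
    {S : Set (Fin θ → X)} (hS : MeasurableSet S) :
    (Measure.infinitePi fun _ : ℕ => μ).real {ξ | (fun j : Fin θ => ξ j) ∈ S} =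
      (Measure.pi fun _ : Fin θ => μ).real S := by
  have hmap : (Measure.infinitePi fun _ : ℕ => μ).map (fun ξ (j : Fin θ) => ξ j) =
      Measure.pi fun _ : Fin θ => μ := by
    rw [Measure.map_infinitePi_infinitePi_of_inj (P := fun _ : ℕ => μ) Fin.val_injective,
      Measure.infinitePi_eq_pi]
  rw [← hmap, map_measureReal_apply (by fun_prop) hS]
  rfl

theorem measureReal_prod_le_of_forall {μ : Measure X} {ν : Measure Y} [IsProbabilityMeasure μ]
    [IsProbabilityMeasure ν] {E : Set (X × Y)} (hE : MeasurableSet E) {p : ℝ}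
    (hp : ∀ x, ν.real (Prod.mk x ⁻¹' E) ≤ p) : (μ.prod ν).real E ≤ p := by
  obtain ⟨x₀⟩ := nonempty_of_isProbabilityMeasure μ
  have hp₀ : 0 ≤ p := measureReal_nonneg.trans (hp x₀)
  refine ENNReal.toReal_le_of_le_ofReal hp₀ ?_
  calc μ.prod ν E = ∫⁻ x, ν (Prod.mk x ⁻¹' E) ∂μ := Measure.prod_apply hE
    _ ≤ ∫⁻ _, ENNReal.ofReal p ∂μ := lintegral_mono fun x =>
        (ENNReal.le_ofReal_iff_toReal_le (measure_ne_top _ _) hp₀).2 (hp x)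
    _ = ENNReal.ofReal p := by simp

theorem measurableSet_setOf_mem_of_dependsOn {ι β : Type*} [Countable X]
    [MeasurableSingletonClass X] [Nonempty β] {I : Finset ι} {f : (ι → X) → β}
    (hf : DependsOn f I) {B : β → Set Y} (hB : ∀ b, MeasurableSet (B b)) :
    MeasurableSet {ω : (ι → X) × Y | ω.2 ∈ B (f ω.1)} := by
  obtain ⟨g, rfl⟩ := dependsOn_iff_exists_comp.1 hf
  let restrict : (ι → X) → I → X := (I : Set ι).domRestrict
  have hrestrict : Measurable restrict := measurable_pi_lambda _ fun i => measurable_pi_apply _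
  have hunion : {ω : (ι → X) × Y | ω.2 ∈ B (g (restrict ω.1))} =
      ⋃ y, (restrict ⁻¹' {y}) ×ˢ B (g y) := by
    ext ω
    simp
  exact hunion ▸ .iUnion fun y => (hrestrict (measurableSet_singleton y)).prod (hB _)

end Sampling

section Influence

variable {V : Type*}

/-- The probability that `R` is hit when each node `v` is independently a seed with
probability `q v`. -/
def hitProb (q : V → ℝ) (R : Finset V) : ℝ := 1 - ∏ v ∈ R, (1 - q v)

theorem hitProb_mem {q : V → ℝ} (hq : ∀ v, q v ∈ Set.Icc (0 : ℝ) 1) (R : Finset V) :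
    hitProb q R ∈ Set.Icc (0 : ℝ) 1 := by
  have hprod₀ : 0 ≤ ∏ v ∈ R, (1 - q v) := Finset.prod_nonneg fun v _ => sub_nonneg.2 (hq v).2
  have hprod₁ : ∏ v ∈ R, (1 - q v) ≤ 1 :=
    Finset.prod_le_one (fun v _ => sub_nonneg.2 (hq v).2) fun v _ => sub_le_self 1 (hq v).1
  exact ⟨sub_nonneg.2 hprod₁, sub_le_self 1 hprod₀⟩

variable [Fintype V] [DecidableEq V]

theorem mem_finalActive_iff (T : V → Finset V) (S : Finset V) (v : V) :
    v ∈ finalActive T S ↔ ∃ u ∈ rrSet v T, u ∈ S := by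
  simp only [finalActive, rrSet, Finset.mem_filter, Finset.mem_univ, true_and]
  constructor
  · rintro ⟨t, ht⟩
    induction t generalizing v with
    | zero => exact ⟨v, .refl, ht⟩
    | succ t ih =>
      simp only [activeAt, Finset.mem_union, Finset.mem_filter, Finset.mem_univ, true_and] at ht
      rcases ht with ht | ⟨w, hw⟩
      · exact ih v ht
      · obtain ⟨hwT, hwA⟩ := Finset.mem_inter.1 hw
        obtain ⟨u, hu, huS⟩ := ih w hwA
        exact ⟨u, hu.tail hwT, huS⟩
  · rintro ⟨u, hu, huS⟩
    induction hu with
    | refl => exact ⟨0, huS⟩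
    | tail _ hbc ih =>
      obtain ⟨t, ht⟩ := ih
      refine ⟨t + 1, ?_⟩
      simp only [activeAt, Finset.mem_union, Finset.mem_filter, Finset.mem_univ, true_and]
      exact Or.inr ⟨_, Finset.mem_inter.2 ⟨hbc, ht⟩⟩

theorem card_finalActive (T : V → Finset V) (S : Finset V) :
    ((finalActive T S).card : ℝ) = ∑ v, if ∃ u ∈ rrSet v T, u ∈ S then (1 : ℝ) else 0 := by
  rw [Finset.sum_boole]
  congr 2
  ext v
  simp [mem_finalActive_iff]

theorem sum_prod_mul_prod_compl (p q : V → ℝ) :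
    ∑ S : Finset V, (∏ u ∈ S, p u) * ∏ v ∈ Sᶜ, q v = ∏ v, (p v + q v) := by
  simp only [Finset.prod_add, Finset.powerset_univ, Finset.compl_eq_univ_sdiff]

/-- Subsets missing `R` are selected by setting the seed probabilities on `R` to zero. -/
theorem sum_hit_eq_hitProb (q : V → ℝ) (R : Finset V) :
    ∑ S : Finset V, (if ∃ u ∈ R, u ∈ S then (1 : ℝ) else 0) *
      ((∏ u ∈ S, q u) * ∏ v ∈ Sᶜ, (1 - q v)) = hitProb q R := by
  let q' (u : V) : ℝ := if u ∈ R then 0 else q u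
  have htotal : ∑ S : Finset V, (∏ u ∈ S, q u) * ∏ v ∈ Sᶜ, (1 - q v) = 1 := by
    simp [sum_prod_mul_prod_compl]
  have hmiss : ∑ S : Finset V, (∏ u ∈ S, q' u) * ∏ v ∈ Sᶜ, (1 - q v) = ∏ v ∈ R, (1 - q v) := by
    rw [sum_prod_mul_prod_compl, ← Finset.prod_subset (Finset.subset_univ R)
      fun v _ hv => by simp [q', hv]]
    exact Finset.prod_congr rfl fun v hv => by simp [q', hv]
  rw [hitProb, eq_sub_iff_add_eq, ← hmiss, ← Finset.sum_add_distrib]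
  refine (Finset.sum_congr rfl fun S _ => ?_).trans htotal
  split_ifs with hRS
  · obtain ⟨u, huR, huS⟩ := hRS
    rw [Finset.prod_eq_zero (f := q') huS (if_pos huR), zero_mul, one_mul, add_zero]
  · have : ∏ u ∈ S, q' u = ∏ u ∈ S, q u :=
      Finset.prod_congr rfl fun u hu => if_neg fun huR => hRS ⟨u, huR, hu⟩
    rw [this, zero_mul, zero_add]

end Influence

theorem IsLipschitzOn.lipschitzOnWith {d : ℕ} {f : EuclideanSpace ℝ (Fin d) → ℝ} {L : ℝ≥0}
    {P : Set (EuclideanSpace ℝ (Fin d))} (hf : IsLipschitzOn f L P) : LipschitzOnWith L f P :=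
  LipschitzOnWith.of_dist_le_mul fun x hx y hy => by
    rw [Real.dist_eq, dist_eq_norm]
    exact hf x hx y hy

namespace CIMBS

section Influence

variable {V : Type*} [Fintype V] {d : ℕ} (M : CIMBS V d)

theorem integral_rrLaw (f : Finset V → ℝ) :
    ∫ R, f R ∂M.rrLaw = (Fintype.card V : ℝ)⁻¹ * ∑ v, ∫ T, f (rrSet v T) ∂M.trigMeasure := by
  have hmap (v : V) : ∫ R, f R ∂M.trigMeasure.map (rrSet v) = ∫ T, f (rrSet v T) ∂M.trigMeasure :=
    integral_map (measurable_of_countable _).aemeasurable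
      (measurable_of_countable _).aestronglyMeasurable
  rw [rrLaw, integral_smul_measure, integral_finsetSum_measure fun v _ => .of_finite]
  simp only [hmap, ENNReal.toReal_inv, ENNReal.toReal_natCast, smul_eq_mul]

theorem ae_mem_support_trig : ∀ᵐ T ∂M.trigMeasure, ∀ v, T v ∈ (M.trig v).support := by
  refine ae_all_iff.2 fun v => ?_
  have hv : ∀ᵐ S ∂(M.trig v).toMeasure, S ∈ (M.trig v).support := by
    rw [ae_iff, PMF.toMeasure_apply_eq_zero_iff _ (Set.toFinite _).measurableSet]
    exact Set.disjoint_left.2 fun S hS hS' => hS' hS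
  exact (measurePreserving_eval (fun v => (M.trig v).toMeasure) v).quasiMeasurePreserving.ae hv

theorem ae_isRRSet : ∀ᵐ R ∂M.rrLaw, M.IsRRSet R := by
  have hroot (v : V) : (M.trigMeasure.map (rrSet v)) {R | ¬ M.IsRRSet R} = 0 := by
    rw [Measure.map_apply (measurable_of_countable _) (Set.toFinite _).measurableSet]
    exact measure_mono_null (fun T hT hsupp => hT ⟨v, T, hsupp, rfl⟩) M.ae_mem_support_trig
  rw [ae_iff, rrLaw]
  simp [hroot]

variable [DecidableEq V]

theorem g_eq_integral [Nonempty V] (x : EuclideanSpace ℝ (Fin d)) :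
    M.g x = Fintype.card V * ∫ R, hitProb (fun v => M.h v x) R ∂M.rrLaw := by
  have hn : (Fintype.card V : ℝ) ≠ 0 := by exact_mod_cast Fintype.card_ne_zero
  rw [integral_rrLaw, mul_inv_cancel_left₀ hn,
    ← integral_finsetSum _ fun _ _ => Integrable.of_finite]
  simp only [g, spread, mul_assoc, ← integral_mul_const]
  rw [← integral_finsetSum _ fun _ _ => Integrable.of_finite]
  refine integral_congr_ae (ae_of_all _ fun T => ?_)
  simp only [← sum_hit_eq_hitProb, card_finalActive, Finset.sum_mul]
  exact Finset.sum_comm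

end Influence

section Objective

variable {V : Type*} {d : ℕ} (M : CIMBS V d)

theorem feasible_convex : Convex ℝ M.feasible := M.cost_convex.convex_le M.budget

theorem h_mem_of_feasible {x : EuclideanSpace ℝ (Fin d)} (hx : x ∈ M.feasible) (v : V) :
    M.h v x ∈ Set.Icc (0 : ℝ) 1 := M.h_mem v x (M.dom_nonneg x hx.1)

theorem s_nonneg {x : EuclideanSpace ℝ (Fin d)} (hx : x ∈ M.feasible) : 0 ≤ M.s x :=
  mul_nonneg M.lam_nonneg (sub_nonneg.2 hx.2)

variable [Fintype V]

/-- The estimate `ĝ_R + s` of the objective from the single RR set `R`. -/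
def sampleObjective (R : Finset V) (x : EuclideanSpace ℝ (Fin d)) : ℝ :=
  Fintype.card V * hitProb (fun v => M.h v x) R + M.s x

theorem sampleObjective_nonneg {x : EuclideanSpace ℝ (Fin d)} (hx : x ∈ M.feasible)
    (R : Finset V) : 0 ≤ M.sampleObjective R x :=
  add_nonneg (mul_nonneg (Nat.cast_nonneg _) (hitProb_mem (M.h_mem_of_feasible hx) R).1)
    (M.s_nonneg hx)

theorem sampleObjective_le_add_card {x : EuclideanSpace ℝ (Fin d)} (hx : x ∈ M.feasible)
    (R R' : Finset V) : M.sampleObjective R x ≤ M.sampleObjective R' x + Fintype.card V := by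
  have hR := (hitProb_mem (M.h_mem_of_feasible hx) R).2
  have hR' := (hitProb_mem (M.h_mem_of_feasible hx) R').1
  have : (0 : ℝ) ≤ Fintype.card V := Nat.cast_nonneg _
  simp only [sampleObjective]
  nlinarith

theorem sampleAverage_sampleObjective {θ : ℕ} (hθ : 0 < θ) (R : Fin θ → Finset V)
    (x : EuclideanSpace ℝ (Fin d)) :
    sampleAverage R (fun S => M.sampleObjective S x) = M.gHat R x + M.s x := by
  simp only [sampleObjective]
  rw [sampleAverage_add, sampleAverage_const_mul, sampleAverage_const hθ, gHat, sampleAverage]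
  simp only [hitProb]
  ring

theorem lipschitzOnWith_sampleObjective {R : Finset V} {L : ℝ≥0}
    (hLip : IsLipschitzOn (fun x => M.gHat (fun _ : Fin 1 => R) x + M.s x) L M.feasible) :
    LipschitzOnWith L (M.sampleObjective R) M.feasible := by
  have heq : M.sampleObjective R = fun x => M.gHat (fun _ : Fin 1 => R) x + M.s x :=
    funext fun x => by simp [← M.sampleAverage_sampleObjective one_pos, sampleAverage]
  exact heq ▸ hLip.lipschitzOnWith

theorem integral_sampleObjective [DecidableEq V] [Nonempty V]
    (x : EuclideanSpace ℝ (Fin d)) : ∫ R, M.sampleObjective R x ∂M.rrLaw = M.g x + M.s x := by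
  simp only [sampleObjective]
  rw [integral_add .of_finite .of_finite, integral_const_mul, g_eq_integral]
  simp

theorem le_opt [DecidableEq V] (hopt : 1 ≤ M.opt) {x : EuclideanSpace ℝ (Fin d)}
    (hx : x ∈ M.feasible) : M.g x + M.s x ≤ M.opt := by
  refine le_csSup ?_ ⟨x, hx, rfl⟩
  by_contra hunbdd
  have : M.opt = 0 := Real.sSup_of_not_bddAbove hunbdd
  linarith

theorem feasible_nonempty [DecidableEq V] (hopt : 1 ≤ M.opt) : M.feasible.Nonempty := by
  by_contra hempty
  have : M.opt = 0 := by simp [opt, Set.not_nonempty_iff_eq_empty.1 hempty]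
  linarith

/-- `F` extends the estimates of the objective from single RR sets to a payoff family on the closure
of the feasible region. The activation functions and the cost need not extend continuously, but
each estimate that can occur does; the value of `F` at impossible RR sets is immaterial. -/
structure IsObjectiveExtension (F : EuclideanSpace ℝ (Fin d) → Finset V → ℝ) (L : ℝ≥0) : Prop
    extends IsPayoffFamily F (closure M.feasible) (Fintype.card V) L where
  eq_sampleObjective :
    ∀ R, M.IsRRSet R → ∀ x ∈ M.feasible, F x R = M.sampleObjective R x

theorem exists_isObjectiveExtension [Nonempty V] {L : ℝ≥0}
    (hLip : ∀ R, M.IsRRSet R → LipschitzOnWith L (M.sampleObjective R) M.feasible) :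
    ∃ F, M.IsObjectiveExtension F L := by
  classical
  obtain ⟨R₀, hR₀⟩ := M.ae_isRRSet.exists
  let possible (R : Finset V) : Finset V := if M.IsRRSet R then R else R₀
  have hpossible (R : Finset V) : M.IsRRSet (possible R) := by
    unfold possible
    split_ifs with hR
    exacts [hR, hR₀]
  choose G hGLip hG using fun R => (hLip _ (hpossible R)).extend_real
  have hGcont (R : Finset V) : ContinuousOn (G R) (closure M.feasible) :=
    (hGLip R).continuous.continuousOn
  refine ⟨fun x R => G R x, ⟨fun y hy => ⟨measurable_of_countable _, fun R => ?_, fun R R' => ?_⟩,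
    fun R => (hGLip R).lipschitzOnWith⟩, fun R hR x hx => ?_⟩
  · refine le_on_closure (fun x hx => ?_) continuousOn_const (hGcont R) hy
    exact (M.sampleObjective_nonneg hx _).trans_eq (hG R hx)
  · refine le_on_closure (g := fun x => G R' x + Fintype.card V) (fun x hx => ?_) (hGcont R)
      ((hGcont R').add continuousOn_const) hy
    rw [← hG R hx, ← hG R' hx]
    exact M.sampleObjective_le_add_card hx _ _
  · rw [← hG R hx]
    simp only [possible, if_pos hR]

namespace IsObjectiveExtension

variable {M} {F : EuclideanSpace ℝ (Fin d) → Finset V → ℝ} {L : ℝ≥0}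

theorem sampleAverage_eq (hF : M.IsObjectiveExtension F L) {θ : ℕ} (hθ : 0 < θ)
    {R : Fin θ → Finset V} (hR : ∀ j, M.IsRRSet (R j)) {x : EuclideanSpace ℝ (Fin d)}
    (hx : x ∈ M.feasible) : sampleAverage R (F x) = M.gHat R x + M.s x := by
  rw [← M.sampleAverage_sampleObjective hθ]
  exact sampleAverage_congr fun j => hF.eq_sampleObjective _ (hR j) x hx

theorem mul_sampleAverage_sub_le (hF : M.IsObjectiveExtension F L) {α δ : ℝ}
    {A : (θ : ℕ) → (Fin θ → Finset V) → EuclideanSpace ℝ (Fin d)}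
    (hA : M.IsApproxGradientAlgorithm A α δ) {θ : ℕ} (hθ : 0 < θ) {R : Fin θ → Finset V}
    (hR : ∀ j, M.IsRRSet (R j)) {y : EuclideanSpace ℝ (Fin d)} (hy : y ∈ closure M.feasible) :
    α * sampleAverage R (F y) - δ ≤ sampleAverage R (F (A θ R)) := by
  have hcont := (hF.lipschitzOnWith_sampleAverage R).continuousOn
  obtain ⟨hmem, happrox⟩ := hA θ R hR
  refine le_on_closure (f := fun x => α * sampleAverage R (F x) - δ) (fun x hx => ?_)
    ((continuousOn_const.mul hcont).sub continuousOn_const) continuousOn_const hy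
  rw [hF.sampleAverage_eq hθ hR hx, hF.sampleAverage_eq hθ hR hmem]
  exact happrox hθ x hx

variable [DecidableEq V] [Nonempty V]

theorem integral_eq (hF : M.IsObjectiveExtension F L) {x : EuclideanSpace ℝ (Fin d)}
    (hx : x ∈ M.feasible) : ∫ R, F x R ∂M.rrLaw = M.g x + M.s x := by
  rw [← M.integral_sampleObjective]
  exact integral_congr_ae <| M.ae_isRRSet.mono fun R hR => hF.eq_sampleObjective R hR x hx

theorem lipschitzOnWith_closure (hF : M.IsObjectiveExtension F L) {L₁ : ℝ≥0}
    (hLip : LipschitzOnWith L₁ (fun x => M.g x + M.s x) M.feasible) :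
    LipschitzOnWith L₁ (fun y => ∫ R, F y R ∂M.rrLaw) (closure M.feasible) := by
  refine LipschitzOnWith.closure hF.lipschitzOnWith_integral.continuousOn fun x hx y hy => ?_
  rw [hF.integral_eq hx, hF.integral_eq hy]
  exact hLip hx hy

theorem integral_le_opt (hF : M.IsObjectiveExtension F L) (hopt : 1 ≤ M.opt)
    {y : EuclideanSpace ℝ (Fin d)} (hy : y ∈ closure M.feasible) :
    ∫ R, F y R ∂M.rrLaw ≤ M.opt :=
  le_on_closure (fun _ hx => (hF.integral_eq hx).trans_le (M.le_opt hopt hx))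
    hF.lipschitzOnWith_integral.continuousOn continuousOn_const hy

theorem exists_integral_eq_opt (hF : M.IsObjectiveExtension F L)
    (hbdd : Bornology.IsBounded M.feasible) (hopt : 1 ≤ M.opt) :
    ∃ y ∈ closure M.feasible, ∫ R, F y R ∂M.rrLaw = M.opt := by
  have hne := M.feasible_nonempty hopt
  obtain ⟨y, hy, hmax⟩ := hbdd.isCompact_closure.exists_isMaxOn hne.closure
    (hF.lipschitzOnWith_integral (μ := M.rrLaw)).continuousOn
  refine ⟨y, hy, le_antisymm (hF.integral_le_opt hopt hy) (csSup_le (hne.image _) ?_)⟩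
  rintro _ ⟨x, hx, rfl⟩
  exact (hF.integral_eq hx).symm.trans_le (hmax (subset_closure hx))

/-- At a maximizer of a positive estimate, `α > 1` would contradict the guarantee for small additive
errors. -/
theorem approxRatio_le_one (hF : M.IsObjectiveExtension F L)
    (hbdd : Bornology.IsBounded M.feasible) (hopt : 1 ≤ M.opt) {α : ℝ}
    {A : ℝ → (θ : ℕ) → (Fin θ → Finset V) → EuclideanSpace ℝ (Fin d)}
    (hA : ∀ δ : ℝ, 0 < δ → M.IsApproxGradientAlgorithm (A δ) α δ) : α ≤ 1 := by
  obtain ⟨y₀, hy₀, hy₀_opt⟩ := hF.exists_integral_eq_opt hbdd hopt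
  obtain ⟨S, hS, hS_opt⟩ := exists_notMem_null_integral_le (μ := M.rrLaw)
    (hF.isPayoff y₀ hy₀).integrable (ae_iff.1 M.ae_isRRSet)
  let R : Fin 1 → Finset V := fun _ => S
  have hR (j : Fin 1) : M.IsRRSet (R j) := not_not.1 hS
  obtain ⟨y, hy, hmax⟩ := hbdd.isCompact_closure.exists_isMaxOn ⟨y₀, hy₀⟩
    (hF.lipschitzOnWith_sampleAverage R).continuousOn
  have hpos : 0 < sampleAverage R (F y) :=
    calc 0 < ∫ R, F y₀ R ∂M.rrLaw := by linarith
      _ ≤ sampleAverage R (F y₀) := by simpa [sampleAverage, R] using hS_opt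
      _ ≤ sampleAverage R (F y) := hmax hy₀
  refine le_of_mul_le_mul_right (le_of_forall_pos_le_add fun δ hδ => ?_) hpos
  have happrox := hF.mul_sampleAverage_sub_le (hA δ hδ) one_pos hR hy
  have hle : sampleAverage R (F (A δ 1 R)) ≤ sampleAverage R (F y) :=
    hmax (subset_closure (hA δ hδ 1 R hR).1)
  linarith

theorem measureReal_exists_sampleAverage_ge_le (hF : M.IsObjectiveExtension F L)
    (hbdd : Bornology.IsBounded M.feasible) (hopt : 1 ≤ M.opt) {θ : ℕ} {r a B D : ℝ} (hr : 0 < r)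
    (ha : 0 ≤ a) (hB : M.opt ≤ B) (hD : 0 < D)
    (hθ : Real.log (D * covNum M.feasible r) ≤
      θ * a ^ 2 / (2 * Fintype.card V * (B + a / 3))) :
    (Measure.pi fun _ : Fin θ => M.rrLaw).real
      {R | ∃ y ∈ closure M.feasible, B + a + L * r ≤ sampleAverage R (F y)} ≤ 1 / D := by
  have hne := M.feasible_nonempty hopt
  obtain ⟨N, hN_mem, hN_cover, hN_card⟩ :=
    exists_isCover_closure_card_le_covNum hbdd M.feasible_convex hne hr
  have htail := hF.toIsPayoffFamily.measureReal_exists_sampleAverage_ge_le (μ := M.rrLaw) (θ := θ)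
    (Nat.cast_pos.2 Fintype.card_pos) hN_mem hN_cover (by linarith)
    (fun y hy => (hF.integral_le_opt hopt hy).trans hB) ha
  rw [Real.coe_toNNReal _ hr.le] at htail
  refine htail.trans <| le_trans ?_ <|
    mul_exp_neg_le_one_div (one_pos.trans_le (one_le_covNum hbdd hne hr)) hD hθ
  gcongr

theorem measureReal_exists_value_lt_le (hF : M.IsObjectiveExtension F L)
    (hbdd : Bornology.IsBounded M.feasible) (hopt : 1 ≤ M.opt) {L₁ : ℝ≥0}
    (hLip : LipschitzOnWith L₁ (fun x => M.g x + M.s x) M.feasible)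
    {y₀ : EuclideanSpace ℝ (Fin d)} (hy₀ : y₀ ∈ closure M.feasible)
    (hy₀_opt : ∫ R, F y₀ R ∂M.rrLaw = M.opt) {θ : ℕ} {α e δ r D : ℝ} (he : 0 < e)
    (heα : 3 * e < α) (hα : α ≤ 1) (hδ : δ ≤ e * M.opt) (hr : 0 < r)
    (hrL : (L₁ + L) * r ≤ e * M.opt) (hD : 0 < D)
    (hθ₁ : Real.log D ≤ θ * ((α - e) * e / 2) ^ 2 * M.opt / (2 * Fintype.card V))
    (hθ₂ : Real.log (D * covNum M.feasible r) ≤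
      θ * (e - (α - e) ^ 2 * e / 2) ^ 2 * M.opt / (2 * Fintype.card V * (α - e))) :
    (Measure.pi fun _ : Fin θ => M.rrLaw).real {R | ∃ y ∈ closure M.feasible,
      α * sampleAverage R (F y₀) - δ ≤ sampleAverage R (F y) ∧
        ∫ S, F y S ∂M.rrLaw < (α - 3 * e) * M.opt} ≤ 1 / D + 1 / D := by
  have hne := M.feasible_nonempty hopt
  obtain ⟨N, hN_mem, hN_cover, hN_card⟩ :=
    exists_isCover_closure_card_le_covNum hbdd M.feasible_convex hne hr
  have htail := hF.toIsPayoffFamily.measureReal_exists_value_lt_le (θ := θ) (α := α) (e := e)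
    (δ := δ) (Nat.cast_pos.2 Fintype.card_pos) (hF.lipschitzOnWith_closure hLip) hN_mem hN_cover
    hy₀ (by linarith) he heα hα (by rwa [hy₀_opt]) (by rwa [hy₀_opt, Real.coe_toNNReal _ hr.le])
  rw [hy₀_opt] at htail
  refine htail.trans (add_le_add ?_ ?_)
  · simpa only [one_mul] using mul_exp_neg_le_one_div one_pos hD (by rwa [mul_one])
  · refine le_trans ?_ <|
      mul_exp_neg_le_one_div (one_pos.trans_le (one_le_covNum hbdd hne hr)) hD hθ₂
    gcongr

end IsObjectiveExtension

end Objective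

section SamplingLoop

variable {V : Type*} [Fintype V] {d : ℕ} (M : CIMBS V d)

theorem ae_forall_isRRSet [Nonempty V] (θ : ℕ) :
    ∀ᵐ R ∂(Measure.pi fun _ : Fin θ => M.rrLaw), ∀ j, M.IsRRSet (R j) :=
  ae_all_iff.2 fun j =>
    (measurePreserving_eval (fun _ => M.rrLaw) j).quasiMeasurePreserving.ae M.ae_isRRSet

theorem card_le_total : Fintype.card V ≤ M.total :=
  le_add_of_nonneg_right (mul_nonneg M.lam_nonneg M.budget_nonneg)

theorem guess_pos [Nonempty V] (i : ℕ) : 0 < M.guess i :=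
  div_pos ((Nat.cast_pos.2 Fintype.card_pos).trans_le M.card_le_total) (by positivity)

theorem one_le_logb_total [Nontrivial V] : 1 ≤ Real.logb 2 M.total := by
  have htotal : 2 ≤ M.total := M.card_le_total.trans' (by exact_mod_cast Fintype.one_lt_card)
  rwa [Real.le_logb_iff_rpow_le one_lt_two (two_pos.trans_le htotal), Real.rpow_one]

theorem numIter_le_logb_total [Nontrivial V] : (M.numIter : ℝ) ≤ Real.logb 2 M.total :=
  (Nat.floor_le (sub_nonneg.2 M.one_le_logb_total)).trans (sub_le_self _ zero_le_one)

theorem epsPrime_pos {ε : ℝ} (hε : 0 < ε) : 0 < epsPrime ε := by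
  unfold epsPrime
  positivity

variable {L₁ L₂ : ℝ} {ε ℓ α : ℝ}
  {A : ℝ → (θ : ℕ) → (Fin θ → Finset V) → EuclideanSpace ℝ (Fin d)}

theorem thetaIter_pos [Nontrivial V] (hbdd : Bornology.IsBounded M.feasible)
    (hne : M.feasible.Nonempty) (hL₂ : 0 < L₂) (hε : 0 < ε) (hℓ : 0 < ℓ) (i : ℕ) :
    0 < M.thetaIter L₂ ε ℓ i := by
  have hguess := M.guess_pos i
  have heps := epsPrime_pos hε
  have hcov : 0 ≤ Real.log (covNum M.feasible (ε / 3 / L₂ * M.guess i)) :=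
    Real.log_nonneg (one_le_covNum hbdd hne (by positivity))
  have hcard : 0 < Real.log (Fintype.card V) := Real.log_pos (by exact_mod_cast Fintype.one_lt_card)
  have : 0 < Real.log 2 := Real.log_pos one_lt_two
  have hlogb : 0 ≤ Real.log (Real.logb 2 M.total) := Real.log_nonneg M.one_le_logb_total
  exact Nat.ceil_pos.2 (by positivity)

theorem log_mul_covNum_le_thetaIter_mul [Nontrivial V] (hbdd : Bornology.IsBounded M.feasible)
    (hne : M.feasible.Nonempty) (hL₂ : 0 < L₂) (hε : 0 < ε) {i : ℕ} {B : ℝ}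
    (hB : M.guess i ≤ B) :
    Real.log (2 * (Fintype.card V : ℝ) ^ ℓ * Real.logb 2 M.total *
        covNum M.feasible (ε / 3 / L₂ * M.guess i)) ≤
      M.thetaIter L₂ ε ℓ i * (epsPrime ε * B) ^ 2 /
        (2 * Fintype.card V * (B + epsPrime ε * B / 3)) := by
  have hn : (0 : ℝ) < Fintype.card V := Nat.cast_pos.2 Fintype.card_pos
  have hpow : 0 < (Fintype.card V : ℝ) ^ ℓ := Real.rpow_pos_of_pos hn ℓ
  have hlogb : 0 < Real.logb 2 M.total := one_pos.trans_le M.one_le_logb_total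
  have hguess := M.guess_pos i
  have heps := epsPrime_pos hε
  have hB₀ : 0 < B := hguess.trans_le hB
  have hcov := one_le_covNum hbdd hne (r := ε / 3 / L₂ * M.guess i) (by positivity)
  rw [Real.log_mul (by positivity) (by positivity), Real.log_mul (by positivity) hlogb.ne',
    Real.log_mul two_ne_zero hpow.ne', Real.log_rpow hn]
  set Q := covNum M.feasible (ε / 3 / L₂ * M.guess i)
  set c : ℝ := Real.log Q + ℓ * Real.log (Fintype.card V) + Real.log 2 +
    Real.log (Real.logb 2 M.total)
  have hceil : Fintype.card V * (2 + 2 / 3 * epsPrime ε) * (c / (epsPrime ε ^ 2 * M.guess i)) ≤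
      M.thetaIter L₂ ε ℓ i := Nat.le_ceil _
  rw [← mul_div_assoc, div_le_iff₀ (by positivity)] at hceil
  rw [le_div_iff₀ (by positivity)]
  calc _ = Fintype.card V * (2 + 2 / 3 * epsPrime ε) * c * B := by ring
    _ ≤ M.thetaIter L₂ ε ℓ i * (epsPrime ε ^ 2 * M.guess i) * B := by gcongr
    _ ≤ M.thetaIter L₂ ε ℓ i * (epsPrime ε ^ 2 * B) * B := by gcongr
    _ = M.thetaIter L₂ ε ℓ i * (epsPrime ε * B) ^ 2 := by ring

theorem dependsOn_iterValue (i : ℕ) :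
    DependsOn (fun ξ => M.iterValue L₂ ε ℓ A ξ i) (Set.Iio (M.thetaIter L₂ ε ℓ i)) := by
  intro ξ ξ' hξ
  have hprefix : (fun j : Fin (M.thetaIter L₂ ε ℓ i) => ξ j) =
      fun j : Fin (M.thetaIter L₂ ε ℓ i) => ξ' j :=
    funext fun j => hξ j j.2
  simp only [iterValue, hprefix]

theorem exists_dependsOn_lowerBound :
    ∃ m : ℕ, DependsOn (M.lowerBound L₂ ε ℓ A) (Finset.range m) := by
  classical
  let m := (Finset.range (M.numIter + 1)).sup (M.thetaIter L₂ ε ℓ)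
  refine ⟨m, fun ξ ξ' hξ => ?_⟩
  have hvalue (i : ℕ) (hi : i ≤ M.numIter) :
      M.iterValue L₂ ε ℓ A ξ i = M.iterValue L₂ ε ℓ A ξ' i := by
    have hle : M.thetaIter L₂ ε ℓ i ≤ m :=
      Finset.le_sup (Finset.mem_range.2 (Nat.lt_succ_of_le hi))
    exact M.dependsOn_iterValue i fun j hj => hξ j (Finset.mem_range.2 (lt_of_lt_of_le hj hle))
  have hbreaks : M.Breaks L₂ ε ℓ A ξ = M.Breaks L₂ ε ℓ A ξ' := by
    ext i
    exact and_congr_right fun _ => and_congr_right fun hi => by rw [hvalue i hi]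
  simp only [lowerBound, hbreaks]
  split_ifs with H
  · rw [hvalue _ (Nat.find_spec H).2.1]
  · rfl

theorem lowerBound_pos [Nonempty V] (hε : 0 < ε) (ξ : ℕ → Finset V) :
    0 < M.lowerBound L₂ ε ℓ A ξ := by
  classical
  have heps := epsPrime_pos hε
  unfold lowerBound
  split_ifs with H
  · have hguess := M.guess_pos (Nat.find H)
    have hvalue := (Nat.find_spec H).2.2
    exact div_pos (hvalue.trans_lt' (by positivity)) (by positivity)
  · exact one_pos

variable [DecidableEq V]

theorem exists_le_iterValue_of_opt_lt_lowerBound (hopt : 1 ≤ M.opt) (hε : 0 < ε)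
    {ξ : ℕ → Finset V} (hlt : M.opt < M.lowerBound L₂ ε ℓ A ξ) :
    ∃ i ∈ Finset.Icc 1 M.numIter,
      (1 + epsPrime ε + ε / 3) * max (M.guess i) M.opt ≤ M.iterValue L₂ ε ℓ A ξ i := by
  classical
  have heps := epsPrime_pos hε
  rw [lowerBound] at hlt
  split_ifs at hlt with H
  · obtain ⟨hone, hle, hvalue⟩ := Nat.find_spec H
    rw [lt_div_iff₀' (by positivity)] at hlt
    refine ⟨Nat.find H, Finset.mem_Icc.2 ⟨hone, hle⟩, ?_⟩
    rw [mul_max_of_nonneg _ _ (by positivity)]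
    exact max_le hvalue hlt.le
  · exact absurd hopt hlt.not_ge

theorem measureReal_le_iterValue_le [Nontrivial V] {L₂ : ℝ≥0}
    {F : EuclideanSpace ℝ (Fin d) → Finset V → ℝ} (hF : M.IsObjectiveExtension F L₂)
    (hbdd : Bornology.IsBounded M.feasible) (hopt : 1 ≤ M.opt) (hL₂ : 0 < L₂) (hε : 0 < ε)
    (hℓ : 0 < ℓ) (hA : ∀ δ : ℝ, 0 < δ → M.IsApproxGradientAlgorithm (A δ) α δ) (i : ℕ) :
    (Measure.infinitePi fun _ : ℕ => M.rrLaw).real {ξ |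
      (1 + epsPrime ε + ε / 3) * max (M.guess i) M.opt ≤ M.iterValue L₂ ε ℓ A ξ i} ≤
    1 / (2 * (Fintype.card V : ℝ) ^ ℓ * Real.logb 2 M.total) := by
  have : (0 : ℝ) < Fintype.card V := Nat.cast_pos.2 Fintype.card_pos
  have hlogb : 0 < Real.logb 2 M.total := one_pos.trans_le M.one_le_logb_total
  have heps := epsPrime_pos hε
  have hguess := M.guess_pos i
  have hne := M.feasible_nonempty hopt
  have hθ := M.thetaIter_pos hbdd hne (NNReal.coe_pos.2 hL₂) hε hℓ i
  have hlog := M.log_mul_covNum_le_thetaIter_mul hbdd hne (NNReal.coe_pos.2 hL₂) hε (ℓ := ℓ)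
    (le_max_left (M.guess i) M.opt)
  set θ := M.thetaIter L₂ ε ℓ i
  set B := max (M.guess i) M.opt
  have hB : 0 < B := hguess.trans_le (le_max_left _ _)
  let S : Set (Fin θ → Finset V) := {R | (1 + epsPrime ε + ε / 3) * B ≤
    M.gHat R (A (ε * M.guess i / 3) θ R) + M.s (A (ε * M.guess i / 3) θ R)}
  have hsubset : S ≤ᵐ[Measure.pi fun _ => M.rrLaw] {R | ∃ y ∈ closure M.feasible,
      B + epsPrime ε * B + L₂ * (ε / 3 / L₂ * M.guess i) ≤ sampleAverage R (F y)} := by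
    filter_upwards [M.ae_forall_isRRSet θ] with R hR hle
    have hmem := (hA (ε * M.guess i / 3) (by positivity) θ R hR).1
    refine ⟨_, subset_closure hmem, ?_⟩
    rw [hF.sampleAverage_eq hθ hR hmem]
    calc B + epsPrime ε * B + L₂ * (ε / 3 / L₂ * M.guess i)
        = B + epsPrime ε * B + ε / 3 * M.guess i := by field_simp
      _ ≤ B + epsPrime ε * B + ε / 3 * B := by gcongr; exact le_max_left _ _
      _ = (1 + epsPrime ε + ε / 3) * B := by ring
      _ ≤ _ := hle
  calc (Measure.infinitePi fun _ : ℕ => M.rrLaw).real {ξ | (fun j : Fin θ => ξ j) ∈ S}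
      = (Measure.pi fun _ : Fin θ => M.rrLaw).real S :=
        infinitePi_real_setOf_prefix_mem _ (Set.toFinite S).measurableSet
    _ ≤ _ := ENNReal.toReal_mono (measure_ne_top _ _) (measure_mono_ae hsubset)
    _ ≤ _ := hF.measureReal_exists_sampleAverage_ge_le hbdd hopt (by positivity) (by positivity)
        (le_max_right _ _) (by positivity) hlog

theorem measureReal_opt_lt_lowerBound_le [Nontrivial V] {L₂ : ℝ≥0}
    {F : EuclideanSpace ℝ (Fin d) → Finset V → ℝ} (hF : M.IsObjectiveExtension F L₂)
    (hbdd : Bornology.IsBounded M.feasible) (hopt : 1 ≤ M.opt) (hL₂ : 0 < L₂) (hε : 0 < ε)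
    (hℓ : 0 < ℓ) (hA : ∀ δ : ℝ, 0 < δ → M.IsApproxGradientAlgorithm (A δ) α δ) :
    (Measure.infinitePi fun _ : ℕ => M.rrLaw).real {ξ | M.opt < M.lowerBound L₂ ε ℓ A ξ} ≤
      1 / (2 * (Fintype.card V : ℝ) ^ ℓ) := by
  have hlogb : 0 < Real.logb 2 M.total := one_pos.trans_le M.one_le_logb_total
  let E (i : ℕ) : Set (ℕ → Finset V) :=
    {ξ | (1 + epsPrime ε + ε / 3) * max (M.guess i) M.opt ≤ M.iterValue L₂ ε ℓ A ξ i}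
  have hsubset : {ξ | M.opt < M.lowerBound L₂ ε ℓ A ξ} ⊆ ⋃ i ∈ Finset.Icc 1 M.numIter, E i := by
    intro ξ hξ
    obtain ⟨i, hi, hle⟩ := M.exists_le_iterValue_of_opt_lt_lowerBound hopt hε hξ
    exact Set.mem_biUnion hi hle
  calc (Measure.infinitePi fun _ : ℕ => M.rrLaw).real {ξ | M.opt < M.lowerBound L₂ ε ℓ A ξ}
      ≤ ∑ i ∈ Finset.Icc 1 M.numIter, (Measure.infinitePi fun _ : ℕ => M.rrLaw).real (E i) :=
        (measureReal_mono hsubset (measure_ne_top _ _)).trans (measureReal_biUnion_finset_le _ _)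
    _ ≤ ∑ i ∈ Finset.Icc 1 M.numIter,
          1 / (2 * (Fintype.card V : ℝ) ^ ℓ * Real.logb 2 M.total) :=
        Finset.sum_le_sum fun i _ => M.measureReal_le_iterValue_le hF hbdd hopt hL₂ hε hℓ hA i
    _ = M.numIter * (1 / (2 * (Fintype.card V : ℝ) ^ ℓ * Real.logb 2 M.total)) := by
        rw [Finset.sum_const, nsmul_eq_mul, Nat.card_Icc, Nat.add_sub_cancel]
    _ ≤ Real.logb 2 M.total * (1 / (2 * (Fintype.card V : ℝ) ^ ℓ * Real.logb 2 M.total)) := by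
        gcongr
        exact M.numIter_le_logb_total
    _ = 1 / (2 * (Fintype.card V : ℝ) ^ ℓ) := by field_simp

theorem sampleLaw_real_opt_lt_lowerBound_le [Nontrivial V] {L₂ : ℝ≥0}
    {F : EuclideanSpace ℝ (Fin d) → Finset V → ℝ} (hF : M.IsObjectiveExtension F L₂)
    (hbdd : Bornology.IsBounded M.feasible) (hopt : 1 ≤ M.opt) (hL₂ : 0 < L₂) (hε : 0 < ε)
    (hℓ : 0 < ℓ) (hA : ∀ δ : ℝ, 0 < δ → M.IsApproxGradientAlgorithm (A δ) α δ) :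
    M.sampleLaw.real {ω | M.opt < M.lowerBound L₂ ε ℓ A ω.1} ≤
      1 / (2 * (Fintype.card V : ℝ) ^ ℓ) := by
  have hprod : {ω : (ℕ → Finset V) × (ℕ → Finset V) | M.opt < M.lowerBound L₂ ε ℓ A ω.1} =
      {ξ | M.opt < M.lowerBound L₂ ε ℓ A ξ} ×ˢ Set.univ := by
    ext ω
    simp
  rw [hprod, sampleLaw, measureReal_prod_prod, probReal_univ, mul_one]
  exact M.measureReal_opt_lt_lowerBound_le hF hbdd hopt hL₂ hε hℓ hA

end SamplingLoop

section FinalSampling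

variable {V : Type*} [Fintype V] {d : ℕ} (M : CIMBS V d) {L₁ L₂ ε ℓ α LB : ℝ}
  {A : ℝ → (θ : ℕ) → (Fin θ → Finset V) → EuclideanSpace ℝ (Fin d)}

theorem thetaFinal_pos [Nonempty V] (hε : 0 < ε) (hℓ : 0 < ℓ) (hα : ε < α) (hLB : 0 < LB) :
    0 < M.thetaFinal L₁ L₂ ε ℓ α LB := by
  have hn : (1 : ℝ) ≤ Fintype.card V := Nat.one_le_cast.2 Fintype.card_pos
  have hpow : 1 ≤ (Fintype.card V : ℝ) ^ ℓ := Real.one_le_rpow hn hℓ.le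
  have hlog : 0 < Real.log (4 * (Fintype.card V : ℝ) ^ ℓ) := Real.log_pos (by linarith)
  have hα' : 0 < α - ε / 3 := by linarith
  refine Nat.ceil_pos.2 (lt_max_of_lt_left ?_)
  unfold theta1
  positivity

theorem log_le_thetaFinal_mul [Nonempty V] (hε : 0 < ε) (hα : ε < α) (hLB : 0 < LB) {O : ℝ}
    (hO : LB ≤ O) :
    Real.log (4 * (Fintype.card V : ℝ) ^ ℓ) ≤
      M.thetaFinal L₁ L₂ ε ℓ α LB * ((α - ε / 3) * (ε / 3) / 2) ^ 2 * O /
        (2 * Fintype.card V) := by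
  have : (0 : ℝ) < Fintype.card V := Nat.cast_pos.2 Fintype.card_pos
  have hα' : 0 < α - ε / 3 := by linarith
  have hceil : M.theta1 ε ℓ α LB ≤ M.thetaFinal L₁ L₂ ε ℓ α LB :=
    (le_max_left _ _).trans (Nat.le_ceil _)
  rw [theta1, div_le_iff₀ (by positivity)] at hceil
  have hmono : M.thetaFinal L₁ L₂ ε ℓ α LB * (LB * (α - ε / 3) ^ 2 * (ε ^ 2 / 9)) ≤
      M.thetaFinal L₁ L₂ ε ℓ α LB * (O * (α - ε / 3) ^ 2 * (ε ^ 2 / 9)) := by gcongr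
  rw [le_div_iff₀ (by positivity)]
  linarith

theorem log_mul_covNum_le_thetaFinal_mul [Nonempty V] (hε : 0 < ε) (hα : ε < α) (hα₁ : α ≤ 1)
    (hLB : 0 < LB) {O : ℝ} (hO : LB ≤ O) :
    Real.log (4 * (Fintype.card V : ℝ) ^ ℓ * covNum M.feasible (ε / 3 / (L₁ + L₂) * LB)) ≤
      M.thetaFinal L₁ L₂ ε ℓ α LB * (ε / 3 - (α - ε / 3) ^ 2 * (ε / 3) / 2) ^ 2 * O /
        (2 * Fintype.card V * (α - ε / 3)) := by
  have : (0 : ℝ) < Fintype.card V := Nat.cast_pos.2 Fintype.card_pos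
  have hα' : 0 < α - ε / 3 := by linarith
  have hα'_sq : (α - ε / 3) ^ 2 ≤ 1 := pow_le_one₀ hα'.le (by linarith)
  have hden : 0 < ε / 3 - 1 / 2 * (α - ε / 3) ^ 2 * (ε / 3) := by nlinarith
  have hceil : M.theta2 L₁ L₂ ε ℓ α LB ≤ M.thetaFinal L₁ L₂ ε ℓ α LB :=
    (le_max_right _ _).trans (Nat.le_ceil _)
  rw [theta2, div_le_iff₀ (by positivity)] at hceil
  have hmono : M.thetaFinal L₁ L₂ ε ℓ α LB *
        ((ε / 3 - 1 / 2 * (α - ε / 3) ^ 2 * (ε / 3)) ^ 2 * LB) ≤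
      M.thetaFinal L₁ L₂ ε ℓ α LB *
        ((ε / 3 - 1 / 2 * (α - ε / 3) ^ 2 * (ε / 3)) ^ 2 * O) := by gcongr
  rw [le_div_iff₀ (by positivity)]
  linarith

variable [DecidableEq V]

/-- The feasible strategy mixes whose value is at least `ρ` times the optimum. -/
def nearOptimal (ρ : ℝ) : Set (EuclideanSpace ℝ (Fin d)) :=
  {x | x ∈ M.feasible ∧ ρ * M.opt ≤ M.g x + M.s x}

variable [Nonempty V]

theorem feasible_subset_nearOptimal (hopt : 1 ≤ M.opt) {ρ : ℝ} (hρ : ρ ≤ 0) :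
    M.feasible ⊆ M.nearOptimal ρ := by
  intro x hx
  refine ⟨hx, (mul_nonpos_of_nonpos_of_nonneg hρ (zero_le_one.trans hopt)).trans ?_⟩
  rw [← M.integral_sampleObjective]
  exact integral_nonneg (M.sampleObjective_nonneg hx)

theorem measureReal_notMem_nearOptimal_le_of_lt {L₁ L₂ : ℝ≥0}
    {F : EuclideanSpace ℝ (Fin d) → Finset V → ℝ} (hF : M.IsObjectiveExtension F L₂)
    (hbdd : Bornology.IsBounded M.feasible) (hopt : 1 ≤ M.opt) (hL₂ : 0 < L₂)
    (hLip : LipschitzOnWith L₁ (fun x => M.g x + M.s x) M.feasible) (hε : 0 < ε) (hℓ : 0 < ℓ)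
    (hεα : ε < α) (hA : ∀ δ : ℝ, 0 < δ → M.IsApproxGradientAlgorithm (A δ) α δ) (hLB : 0 < LB)
    (hLB_opt : LB ≤ M.opt) :
    (Measure.pi fun _ : Fin (M.thetaFinal L₁ L₂ ε ℓ α LB) => M.rrLaw).real
      {R | A (ε / 3 * LB) _ R ∉ M.nearOptimal (α - ε)} ≤ 1 / (2 * (Fintype.card V : ℝ) ^ ℓ) := by
  have : 0 < (Fintype.card V : ℝ) ^ ℓ :=
    Real.rpow_pos_of_pos (Nat.cast_pos.2 Fintype.card_pos) ℓ
  have hα := hF.approxRatio_le_one hbdd hopt hA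
  have hθ := M.thetaFinal_pos (L₁ := L₁) (L₂ := L₂) hε hℓ hεα hLB
  have hlog₁ := M.log_le_thetaFinal_mul (L₁ := L₁) (L₂ := L₂) (ℓ := ℓ) hε hεα hLB hLB_opt
  have hlog₂ := M.log_mul_covNum_le_thetaFinal_mul (L₁ := L₁) (L₂ := L₂) (ℓ := ℓ)
    hε hεα hα hLB hLB_opt
  set θ := M.thetaFinal L₁ L₂ ε ℓ α LB
  have hδ : ε / 3 * LB ≤ ε / 3 * M.opt := by gcongr
  have hrL : (L₁ + L₂) * (ε / 3 / (L₁ + L₂) * LB) ≤ ε / 3 * M.opt := by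
    rwa [← mul_assoc, mul_div_cancel₀ _ (by positivity)]
  obtain ⟨y₀, hy₀, hy₀_opt⟩ := hF.exists_integral_eq_opt hbdd hopt
  have hsubset : {R : Fin θ → Finset V | A (ε / 3 * LB) θ R ∉ M.nearOptimal (α - ε)}
      ≤ᵐ[Measure.pi fun _ => M.rrLaw] {R | ∃ y ∈ closure M.feasible,
        α * sampleAverage R (F y₀) - ε / 3 * LB ≤ sampleAverage R (F y) ∧
          ∫ S, F y S ∂M.rrLaw < (α - 3 * (ε / 3)) * M.opt} := by
    filter_upwards [M.ae_forall_isRRSet θ] with R hR hbad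
    have happrox := hA (ε / 3 * LB) (by positivity)
    have hmem := (happrox θ R hR).1
    refine ⟨_, subset_closure hmem, hF.mul_sampleAverage_sub_le happrox hθ hR hy₀, ?_⟩
    rw [hF.integral_eq hmem, mul_div_cancel₀ ε three_ne_zero]
    exact not_le.1 fun hle => hbad ⟨hmem, hle⟩
  calc (Measure.pi fun _ : Fin θ => M.rrLaw).real
        {R | A (ε / 3 * LB) θ R ∉ M.nearOptimal (α - ε)}
      ≤ _ := ENNReal.toReal_mono (measure_ne_top _ _) (measure_mono_ae hsubset)
    _ ≤ 1 / (4 * (Fintype.card V : ℝ) ^ ℓ) + 1 / (4 * (Fintype.card V : ℝ) ^ ℓ) :=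
        hF.measureReal_exists_value_lt_le hbdd hopt hLip hy₀ hy₀_opt (by positivity) (by linarith)
          hα hδ (by positivity) hrL (by positivity) hlog₁ hlog₂
    _ = 1 / (2 * (Fintype.card V : ℝ) ^ ℓ) := by field_simp; norm_num

theorem measureReal_notMem_nearOptimal_le {L₁ L₂ : ℝ≥0}
    {F : EuclideanSpace ℝ (Fin d) → Finset V → ℝ} (hF : M.IsObjectiveExtension F L₂)
    (hbdd : Bornology.IsBounded M.feasible) (hopt : 1 ≤ M.opt) (hL₂ : 0 < L₂)
    (hLip : LipschitzOnWith L₁ (fun x => M.g x + M.s x) M.feasible) (hε : 0 < ε) (hℓ : 0 < ℓ)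
    (hA : ∀ δ : ℝ, 0 < δ → M.IsApproxGradientAlgorithm (A δ) α δ) (hLB : 0 < LB)
    (hLB_opt : LB ≤ M.opt) :
    (Measure.pi fun _ : Fin (M.thetaFinal L₁ L₂ ε ℓ α LB) => M.rrLaw).real
      {R | A (ε / 3 * LB) _ R ∉ M.nearOptimal (α - ε)} ≤ 1 / (2 * (Fintype.card V : ℝ) ^ ℓ) := by
  rcases lt_or_ge ε α with hεα | hαε
  · exact M.measureReal_notMem_nearOptimal_le_of_lt hF hbdd hopt hL₂ hLip hε hℓ hεα hA hLB hLB_opt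
  · have hnear : ∀ᵐ R ∂Measure.pi fun _ : Fin (M.thetaFinal L₁ L₂ ε ℓ α LB) => M.rrLaw,
        A (ε / 3 * LB) _ R ∈ M.nearOptimal (α - ε) := by
      filter_upwards [M.ae_forall_isRRSet _] with R hR
      exact M.feasible_subset_nearOptimal hopt (sub_nonpos.2 hαε)
        (hA (ε / 3 * LB) (by positivity) _ R hR).1
    rw [measureReal_def, ae_iff.1 hnear, ENNReal.toReal_zero]
    positivity

/-- Conditionally on the sampling loop, `LB` and hence the number of fresh RR sets are constant. -/
theorem sampleLaw_real_notMem_nearOptimal_le {L₁ L₂ : ℝ≥0}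
    {F : EuclideanSpace ℝ (Fin d) → Finset V → ℝ} (hF : M.IsObjectiveExtension F L₂)
    (hbdd : Bornology.IsBounded M.feasible) (hopt : 1 ≤ M.opt) (hL₂ : 0 < L₂)
    (hLip : LipschitzOnWith L₁ (fun x => M.g x + M.s x) M.feasible) (hε : 0 < ε) (hℓ : 0 < ℓ)
    (hA : ∀ δ : ℝ, 0 < δ → M.IsApproxGradientAlgorithm (A δ) α δ) :
    M.sampleLaw.real {ω | M.lowerBound L₂ ε ℓ A ω.1 ≤ M.opt ∧
      M.gradRIS L₁ L₂ ε ℓ α A ω ∉ M.nearOptimal (α - ε)} ≤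
      1 / (2 * (Fintype.card V : ℝ) ^ ℓ) := by
  let S (c : ℝ) : Set (Fin (M.thetaFinal L₁ L₂ ε ℓ α c) → Finset V) :=
    {R | A (ε / 3 * c) _ R ∉ M.nearOptimal (α - ε)}
  let B (c : ℝ) : Set (ℕ → Finset V) :=
    {ξ | c ≤ M.opt ∧ (fun j : Fin (M.thetaFinal L₁ L₂ ε ℓ α c) => ξ j) ∈ S c}
  have hS (c : ℝ) : MeasurableSet (S c) := (Set.toFinite _).measurableSet
  have hB (c : ℝ) : MeasurableSet (B c) :=
    (MeasurableSet.const _).inter (measurableSet_preimage (by fun_prop) (hS c))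
  obtain ⟨m, hm⟩ := M.exists_dependsOn_lowerBound (L₂ := L₂) (ε := ε) (ℓ := ℓ) (A := A)
  refine measureReal_prod_le_of_forall (measurableSet_setOf_mem_of_dependsOn hm hB) fun ξ => ?_
  have hLB := M.lowerBound_pos (L₂ := L₂) (ℓ := ℓ) (A := A) hε ξ
  set LB := M.lowerBound L₂ ε ℓ A ξ
  by_cases hLB_opt : LB ≤ M.opt
  · calc (Measure.infinitePi fun _ : ℕ => M.rrLaw).real (B LB)
        ≤ (Measure.infinitePi fun _ : ℕ => M.rrLaw).real
            {ξ | (fun j : Fin (M.thetaFinal L₁ L₂ ε ℓ α LB) => ξ j) ∈ S LB} :=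
          measureReal_mono fun ξ hξ => hξ.2
      _ = (Measure.pi fun _ => M.rrLaw).real (S LB) := infinitePi_real_setOf_prefix_mem _ (hS LB)
      _ ≤ _ := M.measureReal_notMem_nearOptimal_le hF hbdd hopt hL₂ hLip hε hℓ hA hLB hLB_opt
  · have hempty : B LB = ∅ := Set.eq_empty_of_forall_notMem fun ξ hξ => hLB_opt hξ.1
    calc (Measure.infinitePi fun _ : ℕ => M.rrLaw).real (B LB) = 0 := by simp [hempty]
      _ ≤ _ := by positivity

end FinalSampling

end CIMBS

end

theorem theorem1 {V : Type*} [Fintype V] [DecidableEq V] [Nonempty V] {d : ℕ} (M : CIMBS V d)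
    (hbdd : Bornology.IsBounded M.feasible) (hopt : 1 ≤ M.opt)
    (ε ℓ α : ℝ) (hε : 0 < ε) (hℓ : 0 < ℓ) (hα : 0 < α)
    (L₁ L₂ : ℝ) (hL₁ : 0 ≤ L₁) (hL₂ : 0 < L₂)
    (hLip₁ : IsLipschitzOn (fun x => M.g x + M.s x) L₁ M.feasible)
    (hLip₂ : ∀ (θ : ℕ) (R : Fin θ → Finset V), 0 < θ → (∀ j, M.IsRRSet (R j)) →
      IsLipschitzOn (fun x => M.gHat R x + M.s x) L₂ M.feasible)
    (A : ℝ → (θ : ℕ) → (Fin θ → Finset V) → EuclideanSpace ℝ (Fin d))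
    (hA : ∀ δ : ℝ, 0 < δ → M.IsApproxGradientAlgorithm (A δ) α δ) :
    1 - 1 / (Fintype.card V : ℝ) ^ ℓ ≤
      M.sampleLaw.real {ω | M.gradRIS L₁ L₂ ε ℓ α A ω ∈ M.feasible ∧
        (α - ε) * M.opt ≤
          M.g (M.gradRIS L₁ L₂ ε ℓ α A ω) + M.s (M.gradRIS L₁ L₂ ε ℓ α A ω)} := by
  rcases subsingleton_or_nontrivial V with hV | hV
  · have hcard : Fintype.card V = 1 :=
      le_antisymm (Fintype.card_le_one_iff_subsingleton.2 hV) Fintype.card_pos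
    simp [hcard]
  lift L₁ to NNReal using hL₁
  lift L₂ to NNReal using hL₂.le
  have hLip (R : Finset V) (hR : M.IsRRSet R) :
      LipschitzOnWith L₂ (M.sampleObjective R) M.feasible :=
    M.lipschitzOnWith_sampleObjective (hLip₂ 1 _ one_pos fun _ => hR)
  obtain ⟨F, hF⟩ := M.exists_isObjectiveExtension hLip
  have hovershoot := M.sampleLaw_real_opt_lt_lowerBound_le hF hbdd hopt (NNReal.coe_pos.1 hL₂)
    hε hℓ hA
  have hfail := M.sampleLaw_real_notMem_nearOptimal_le hF hbdd hopt (NNReal.coe_pos.1 hL₂)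
    hLip₁.lipschitzOnWith hε hℓ hA
  have hcover : {ω | M.gradRIS L₁ L₂ ε ℓ α A ω ∈ M.nearOptimal (α - ε)}ᶜ ⊆
      {ω | M.opt < M.lowerBound L₂ ε ℓ A ω.1} ∪ {ω | M.lowerBound L₂ ε ℓ A ω.1 ≤ M.opt ∧
        M.gradRIS L₁ L₂ ε ℓ α A ω ∉ M.nearOptimal (α - ε)} :=
    fun ω hω => (lt_or_ge M.opt (M.lowerBound L₂ ε ℓ A ω.1)).imp_right fun hle => ⟨hle, hω⟩
  have hhalves : 1 / (2 * (Fintype.card V : ℝ) ^ ℓ) + 1 / (2 * (Fintype.card V : ℝ) ^ ℓ) =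
      1 / (Fintype.card V : ℝ) ^ ℓ := by field_simp; norm_num
  refine le_trans ?_ (one_sub_le_measureReal_of_compl_subset_union hcover)
  linarith
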